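/- **Conventions.** A rooted tree is unordered: it is determined by the finite multiset of subtrees hanging from its root; a forest is a finite multiset of rooted trees. Let $H_R=\mathbb{C}[\mathcal{T}]$ be the polynomial algebra generated by the set $\mathcal{T}$ of rooted trees, with the forests as a basis, and let $B_+\colon H_R\to H_R$ be the linear map that joins the trees of a forest to a new root. $H_R$ is a Hopf algebra whose coproduct is the algebra morphism with $\Delta\circ B_+=B_+\otimes 1+(\mathrm{id}\otimes B_+)\circ\Delta$, whose counit $\varepsilon$ vanishes on non-empty forests, and whose antipode is denoted $S$. $\mathbb{C}[x]$ is the Hopf algebra with $\Delta x=x\otimes1+1\otimes x$. For a linear functional $\alpha$ on a bialgebra $H$ put $\partial\alpha=(\mathrm{id}\otimes\alpha)\circ\Delta-\alpha(\cdot)1$; a linear map $L\colon H\to H$ is a 1-cocycle if $\Delta\circ L=(\mathrm{id}\otimes L)\circ\Delta+L\otimes1$. For a commutative algebra $A$ and a linear map $L\colon A\to A$ let ${}^{L}\!\rho\colon H_R\to A$ be the unique algebra morphism with ${}^{L}\!\rho\circ B_+=L\circ{}^{L}\!\rho$. Write $\int_0\colon\mathbb{C}[x]\to\mathbb{C}[x]$,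 $x^n\mapsto x^{n+1}/(n+1)$, and let $\star$ be the convolution product of linear maps from $H_R$ to a commutative algebra. **The toy model.** Let $f\colon(0,\infty)\to\mathbb{C}$ and $(c_n)_{n\ge-1}$ in $\mathbb{C}$ be such that, for all $z$ with $\operatorname{Re}z>0$ sufficiently close to $0$, the Mellin transform $F(z)=\int_0^\infty f(\zeta)\zeta^{-z}\,d\zeta$ converges absolutely and $$F(z)=\sum_{n=-1}^{\infty}c_nz^n .$$ (The original toy model is $f(\zeta)=1/(1+\zeta)$, $F(z)=\pi/\sin(\pi z)$.) The regularized Feynman rules are the algebra morphism $\phi$ from $H_R$ to functions of $s>0$ and $z$ with $$\phi_s(B_+(x))=\int_0^\infty f(\zeta)\,(s\zeta)^{-z}\,\phi_{s\zeta}(x)\,d\zeta ,$$ where for each $x\in H_R$ the regulator $z$ is close enough to $0$, with $\operatorname{Re}z>0$. For $\mu>0$ let $R_\mu$ be the momentum scheme, that is, evaluation at $s=\mu$. The renormalized Feynman rules are $\phi_R=Z\star\phi$ with the counterterm $Z=R_\mu\circ\phi\circ S$. The physical limit $\phi_{\mathrm{ph}}\colon H_R\to\mathbb{C}[x]$ is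 defined by $$\phi_{\mathrm{ph}}(h)\big|_{x=\ln(s/\mu)}=\lim_{z\to0}\phi_{R,s}(h)\qquad(h\in H_R,\ s>0).$$ **Theorem.** Define $\eta\in\mathbb{C}[x]'$ by $\eta(x^n)=n!\,(-1)^n c_n$ for $n\ge0$, and $L=-c_{-1}\int_0+\partial\eta$. Then: 1. for every $h\in H_R$ the integral defining $\phi_s(B_+(h))$ converges absolutely and the displayed identity holds for all $s>0$ and all $z$ close enough to $0$ with $\operatorname{Re}z>0$; 2. $L$ is a 1-cocycle of $\mathbb{C}[x]$, and ${}^{L}\!\rho\colon H_R\to\mathbb{C}[x]$ is a morphism of Hopf algebras; 3. for every $\mu>0$, $(Z,\phi_R)$ is the unique Birkhoff decomposition of $\phi$ for $R_\mu$, i.e. the unique pair $(\phi_-,\phi_+)$ of linear maps from $H_R$ to the target algebra of $\phi$ with $\phi_\pm(1)=1$, $\phi_-$ invertible for $\star$, $\phi=\phi_-^{\star-1}\star\phi_+$, $\phi_-(\ker\varepsilon)\subseteq\operatorname{im}R_\mu$ and $\phi_+(\ker\varepsilon)\subseteq\ker R_\mu$; 4. for every $\mu>0$ the physical limit (as $z\to0$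 with $\operatorname{Re}z>0$) exists, is uniquely determined as a map $H_R\to\mathbb{C}[x]$, and $$\phi_{\mathrm{ph}}={}^{L}\!\rho .$$ Moreover, for every $h\in H_R$ and $s>0$ the function $z\mapsto\phi_{R,s}(h)$ continues analytically to a neighbourhood of $z=0$, with value ${}^{L}\!\rho(h)\big|_{x=\ln(s/\mu)}$ at $z=0$. -/

import Mathlib

open scoped TensorProduct Topology

noncomputable section

/-- Finite multisets form a quotient of the polynomial functor of finite tuples. -/
instance multisetQPF : QPF Multiset where
  P := ⟨ℕ, Fin⟩
  abs p := Multiset.ofList (List.ofFn p.2)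
  repr m := ⟨m.toList.length, m.toList.get⟩
  abs_repr m := by
    change ((List.ofFn m.toList.get : List _) : Multiset _) = m
    rw [List.ofFn_get, Multiset.coe_toList]
  abs_map f p := by
    obtain ⟨n, g⟩ := p
    change ((List.ofFn (f ∘ g) : List _) : Multiset _) = Multiset.map f (List.ofFn g : List _)
    rw [Multiset.map_coe, List.map_ofFn]

/-- Unordered rooted trees: the initial algebra of the finite multiset functor, that is, a rooted
tree is the same thing as the finite multiset of the subtrees that hang from its root. -/
def RTree : Type := QPF.Fix Multiset

namespace RTree

/-- The tree obtained by joining the trees of a forest to a new root. -/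
def node (m : Multiset RTree) : RTree := QPF.Fix.mk m

/-- The forest left when the root of a tree is removed. -/
def children (t : RTree) : Multiset RTree := QPF.Fix.dest t

instance : DecidableEq RTree := Classical.decEq _

/-- Recursion on trees. -/
def fold {α : Type} (g : Multiset α → α) : RTree → α := QPF.Fix.rec g

theorem fold_node {α : Type} (g : Multiset α → α) (m : Multiset RTree) :
    fold g (node m) = g (m.map (fold g)) := QPF.Fix.rec_eq g m

theorem children_node (m : Multiset RTree) : children (node m) = m := QPF.Fix.dest_mk m

theorem node_children (t : RTree) : node (children t) = t := QPF.Fix.mk_dest t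

theorem induction {p : RTree → Prop}
    (h : ∀ m : Multiset RTree, (∀ t ∈ m, p t) → p (node m)) (t : RTree) : p t := by
  refine QPF.Fix.ind p (fun m hm => h m ?_) t
  obtain ⟨u, rfl⟩ := hm
  intro t ht
  obtain ⟨⟨s, hs⟩, -, rfl⟩ := Multiset.mem_map.1 ht
  exact hs

end RTree

/-- The algebra of rooted trees: polynomials in the rooted trees. Its monomials are the forests. -/
def HR (K : Type) [CommRing K] : Type := MvPolynomial RTree K

namespace HR

variable {K : Type} [CommRing K]

instance : CommRing (HR K) := inferInstanceAs (CommRing (MvPolynomial RTree K))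
instance : Algebra K (HR K) := inferInstanceAs (Algebra K (MvPolynomial RTree K))

/-- A tree as a generator. -/
def tree (t : RTree) : HR K := (MvPolynomial.X t : MvPolynomial RTree K)

/-- A forest as a basis element, the product of its trees. -/
def forest (m : Multiset RTree) : HR K := (m.map tree).prod

/-- The algebra morphism with prescribed values on the trees. -/
def lift {A : Type} [CommRing A] [Algebra K A] (v : RTree → A) : HR K →ₐ[K] A :=
  (MvPolynomial.aeval v : MvPolynomial RTree K →ₐ[K] A)

/-- The grafting operator `B₊`. -/
def graft : HR K →ₗ[K] HR K :=
  ((MvPolynomial.basisMonomials RTree K).constr K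
    (fun m => (MvPolynomial.X (RTree.node (Finsupp.toMultiset m)) :
      MvPolynomial RTree K)) : MvPolynomial RTree K →ₗ[K] MvPolynomial RTree K)

theorem lift_tree {A : Type} [CommRing A] [Algebra K A] (v : RTree → A) (t : RTree) :
    lift (K := K) v (tree t) = v t := MvPolynomial.aeval_X v t

theorem lift_forest {A : Type} [CommRing A] [Algebra K A] (v : RTree → A)
    (m : Multiset RTree) : lift (K := K) v (forest m) = (m.map v).prod := by
  rw [forest, map_multiset_prod, Multiset.map_map]
  simp only [Function.comp_def, lift_tree]

theorem forest_eq_monomial (m : Multiset RTree) :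
    (forest m : HR K) =
      (MvPolynomial.monomial (Multiset.toFinsupp m) 1 : MvPolynomial RTree K) := by
  induction m using Multiset.induction_on with
  | empty => simp [forest]; rfl
  | cons t m ih =>
    have h : (forest (t ::ₘ m) : HR K) = tree t * forest m := by simp [forest]
    rw [h, ih, ← Multiset.singleton_add, map_add, Multiset.toFinsupp_singleton]
    refine Eq.trans ?_ (MvPolynomial.monomial_single_add (e := 1)).symm
    rw [pow_one]; rfl

theorem graft_forest (m : Multiset RTree) :
    graft (forest m : HR K) = tree (RTree.node m) := by
  rw [forest_eq_monomial]
  have := (MvPolynomial.basisMonomials RTree K).constr_basis K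
    (fun m => (MvPolynomial.X (RTree.node (Finsupp.toMultiset m)) :
      MvPolynomial RTree K)) (Multiset.toFinsupp m)
  rw [MvPolynomial.coe_basisMonomials] at this
  refine Eq.trans this ?_
  rw [Multiset.toFinsupp_toMultiset, tree]

theorem linearMap_ext {M : Type} [AddCommGroup M] [Module K M] {φ ψ : HR K →ₗ[K] M}
    (h : ∀ m, φ (forest m) = ψ (forest m)) : φ = ψ := by
  refine (MvPolynomial.basisMonomials RTree K).ext fun m => ?_
  have := h (Finsupp.toMultiset m)
  rw [forest_eq_monomial, Finsupp.toMultiset_toFinsupp] at this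
  rw [MvPolynomial.coe_basisMonomials]
  exact this

theorem algHom_ext {A : Type} [CommRing A] [Algebra K A] {φ ψ : HR K →ₐ[K] A}
    (h : ∀ m, (∀ t ∈ m, φ (tree t) = ψ (tree t)) →
      φ (graft (forest m)) = ψ (graft (forest m))) : φ = ψ := by
  have key : ∀ t, φ (tree t) = ψ (tree t) := fun t =>
    RTree.induction (p := fun t => φ (tree t) = ψ (tree t))
      (fun m hm => by rw [← graft_forest]; exact h m hm) t
  exact MvPolynomial.algHom_ext key

/-- The algebra morphism `ρ : H_R → A` with `ρ ∘ B₊ = op ∘ ρ` on forests. -/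
def universal {A : Type} [CommRing A] [Algebra K A] (op : A → A) : HR K →ₐ[K] A :=
  lift (RTree.fold fun v => op v.prod)

theorem universal_graft_forest {A : Type} [CommRing A] [Algebra K A] (op : A → A)
    (m : Multiset RTree) :
    universal (K := K) op (graft (forest m)) = op (universal (K := K) op (forest m)) := by
  rw [graft_forest, universal, lift_tree, lift_forest, RTree.fold_node]

/-- The universal property of `(H_R, B₊)`. -/
theorem universal_graft {A : Type} [CommRing A] [Algebra K A] (L : A →ₗ[K] A) (x : HR K) :
    universal (K := K) L (graft x) = L (universal (K := K) L x) := by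
  have : (universal (K := K) L).toLinearMap ∘ₗ graft = L ∘ₗ (universal (K := K) L).toLinearMap :=
    linearMap_ext fun m => universal_graft_forest (K := K) L m
  exact LinearMap.congr_fun this x

theorem forest_congr {A : Type} [CommRing A] [Algebra K A] {φ ψ : HR K →ₐ[K] A}
    {m : Multiset RTree} (h : ∀ t ∈ m, φ (tree t) = ψ (tree t)) :
    φ (forest m) = ψ (forest m) := by
  simp only [forest, map_multiset_prod, Multiset.map_map, Function.comp_def]
  rw [Multiset.map_congr rfl h]

theorem universal_unique {A : Type} [CommRing A] [Algebra K A] (L : A →ₗ[K] A)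
    (ρ : HR K →ₐ[K] A) (h : ∀ x, ρ (graft x) = L (ρ x)) : ρ = universal L :=
  algHom_ext fun m hm => by rw [h, universal_graft, forest_congr hm]

/-- The value of the coproduct on a tree, by recursion through
`Δ ∘ B₊ = B₊ ⊗ 1 + (id ⊗ B₊) ∘ Δ`; the first component only keeps track of the tree. -/
def comulAux : RTree → RTree × (HR K ⊗[K] HR K) :=
  RTree.fold fun v =>
    (RTree.node (v.map Prod.fst),
      tree (RTree.node (v.map Prod.fst)) ⊗ₜ[K] 1 +
        graft.lTensor (HR K) (v.map Prod.snd).prod)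

/-- The coproduct of `H_R`. -/
def coproduct : HR K →ₐ[K] HR K ⊗[K] HR K := lift fun t => (comulAux t).2

/-- The counit of `H_R`. -/
def counit : HR K →ₐ[K] K := lift fun _ => 0

theorem comulAux_fst (t : RTree) : (comulAux (K := K) t).1 = t := by
  refine RTree.induction (p := fun t => (comulAux (K := K) t).1 = t) (fun m hm => ?_) t
  rw [comulAux, RTree.fold_node, ← comulAux]
  simp only [Multiset.map_map, Function.comp_def]
  rw [Multiset.map_congr rfl hm, Multiset.map_id']

theorem coproduct_graft (x : HR K) :
    coproduct (graft x) = graft x ⊗ₜ[K] 1 + graft.lTensor (HR K) (coproduct x) := by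
  have : coproduct.toLinearMap ∘ₗ graft = (TensorProduct.mk K (HR K) (HR K)).flip 1 ∘ₗ graft
      + graft.lTensor (HR K) ∘ₗ (coproduct (K := K)).toLinearMap := by
    refine linearMap_ext fun m => ?_
    simp only [LinearMap.comp_apply, LinearMap.add_apply, LinearMap.flip_apply,
      TensorProduct.mk_apply, AlgHom.toLinearMap_apply]
    rw [graft_forest, coproduct, lift_tree, lift_forest, comulAux, RTree.fold_node]
    simp only [Multiset.map_map, Function.comp_def]
    have h : m.map (fun t => (comulAux (K := K) t).1) = m := by
      rw [Multiset.map_congr rfl (fun t _ => comulAux_fst (K := K) t), Multiset.map_id']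
    rw [comulAux] at h
    rw [h]
  exact LinearMap.congr_fun this x

theorem counit_graft (x : HR K) : counit (graft x) = 0 := by
  have : counit.toLinearMap ∘ₗ graft = (0 : HR K →ₗ[K] K) := by
    refine linearMap_ext fun m => ?_
    change counit (graft (forest m)) = 0
    rw [graft_forest, counit, lift_tree]
  exact LinearMap.congr_fun this x

/-- The bialgebra of rooted trees. -/
instance : Bialgebra K (HR K) := Bialgebra.ofAlgHom coproduct counit
  (by
    refine algHom_ext fun m hm => ?_
    have hx := forest_congr hm
    generalize (forest m : HR K) = x at hx
    change Algebra.TensorProduct.assoc K K K (HR K) (HR K) (HR K)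
      (Algebra.TensorProduct.map coproduct (.id K (HR K)) (coproduct x)) =
      Algebra.TensorProduct.map (.id K (HR K)) coproduct (coproduct x) at hx
    change Algebra.TensorProduct.assoc K K K (HR K) (HR K) (HR K)
      (Algebra.TensorProduct.map coproduct (.id K (HR K)) (coproduct (graft x))) =
      Algebra.TensorProduct.map (.id K (HR K)) coproduct (coproduct (graft x))
    have ha : ∀ y : HR K ⊗[K] HR K,
        Algebra.TensorProduct.assoc K K K (HR K) (HR K) (HR K)
          (Algebra.TensorProduct.map coproduct (.id K (HR K)) (graft.lTensor (HR K) y)) =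
        (graft.lTensor (HR K)).lTensor (HR K)
          (Algebra.TensorProduct.assoc K K K (HR K) (HR K) (HR K)
            (Algebra.TensorProduct.map coproduct (.id K (HR K)) y)) := by
      intro y
      induction y with
      | zero => simp
      | add a b h1 h2 => simp only [map_add, h1, h2]
      | tmul a b =>
        simp only [LinearMap.lTensor_tmul, Algebra.TensorProduct.map_tmul, AlgHom.id_apply]
        generalize coproduct a = w
        induction w with
        | zero => simp
        | add c d h1 h2 => simp only [TensorProduct.add_tmul, map_add, h1, h2]
        | tmul c d => simp
    have hb : ∀ y : HR K ⊗[K] HR K,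
        Algebra.TensorProduct.map (.id K (HR K)) coproduct (graft.lTensor (HR K) y) =
        Algebra.TensorProduct.assoc K K K (HR K) (HR K) (HR K) (graft.lTensor (HR K) y ⊗ₜ 1) +
        (graft.lTensor (HR K)).lTensor (HR K)
          (Algebra.TensorProduct.map (.id K (HR K)) coproduct y) := by
      intro y
      induction y with
      | zero => simp
      | add a b h1 h2 => simp only [TensorProduct.add_tmul, map_add, h1, h2]; abel
      | tmul a b => simp [coproduct_graft, TensorProduct.tmul_add]
    rw [coproduct_graft]
    simp only [map_add, ha, hb, hx, Algebra.TensorProduct.map_tmul, map_one, AlgHom.id_apply,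
      coproduct_graft, TensorProduct.add_tmul, Algebra.TensorProduct.one_def,
      Algebra.TensorProduct.assoc_tmul, add_assoc])
  (by
    refine algHom_ext fun m hm => ?_
    have hx := forest_congr hm
    generalize (forest m : HR K) = x at hx
    simp only [AlgHom.comp_apply] at hx ⊢
    have ha : ∀ y : HR K ⊗[K] HR K,
        Algebra.TensorProduct.map counit (.id K (HR K)) (graft.lTensor (HR K) y) =
        graft.lTensor K (Algebra.TensorProduct.map counit (.id K (HR K)) y) := by
      intro y
      induction y with
      | zero => simp
      | add a b h1 h2 => simp only [map_add, h1, h2]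
      | tmul a b => simp
    rw [coproduct_graft, map_add, ha, hx]
    simp [counit_graft])
  (by
    refine algHom_ext fun m hm => ?_
    have ha : ∀ y : HR K ⊗[K] HR K,
        Algebra.TensorProduct.map (.id K (HR K)) counit (graft.lTensor (HR K) y) = 0 := by
      intro y
      induction y with
      | zero => simp
      | add a b h1 h2 => simp only [map_add, h1, h2, add_zero]
      | tmul a b => simp [counit_graft]
    simp only [AlgHom.comp_apply]
    rw [coproduct_graft, map_add, ha]
    simp)

theorem comul_eq (x : HR K) : Coalgebra.comul (R := K) x = coproduct x := rfl

theorem counit_eq (x : HR K) : Coalgebra.counit (R := K) x = counit x := rfl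

/-- The value of `(S ⊗ id) ∘ Δ` on a tree, by recursion. -/
def antipodeAux : RTree → HR K ⊗[K] HR K :=
  RTree.fold fun v =>
    graft.lTensor (HR K) v.prod -
      LinearMap.mul' K (HR K) (graft.lTensor (HR K) v.prod) ⊗ₜ[K] 1

/-- The antipode of `H_R`. -/
def antipode : HR K →ₐ[K] HR K := lift fun t =>
  -LinearMap.mul' K (HR K) (graft.lTensor (HR K) (t.children.map antipodeAux).prod)

theorem map_antipode_coproduct :
    (Algebra.TensorProduct.map antipode (.id K (HR K))).comp coproduct = lift antipodeAux := by
  refine algHom_ext fun m hm => ?_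
  have hx := forest_congr hm
  simp only [AlgHom.comp_apply] at hx ⊢
  have ha : ∀ y : HR K ⊗[K] HR K,
      Algebra.TensorProduct.map antipode (.id K (HR K)) (graft.lTensor (HR K) y) =
      graft.lTensor (HR K) (Algebra.TensorProduct.map antipode (.id K (HR K)) y) := by
    intro y
    induction y with
    | zero => simp
    | add a b h1 h2 => simp only [map_add, h1, h2]
    | tmul a b => simp
  rw [coproduct_graft, map_add, ha, hx, lift_forest, graft_forest,
    Algebra.TensorProduct.map_tmul, map_one, antipode, lift_tree, lift_tree,
    RTree.children_node, antipodeAux, RTree.fold_node, TensorProduct.neg_tmul]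
  abel

theorem antipode_convolution (x : HR K) :
    LinearMap.mul' K (HR K)
      (Algebra.TensorProduct.map antipode (.id K (HR K)) (coproduct x)) =
      algebraMap K (HR K) (counit x) := by
  have : (Algebra.TensorProduct.lmul' K).comp
      ((Algebra.TensorProduct.map antipode (.id K (HR K))).comp coproduct) =
      (Algebra.ofId K (HR K)).comp counit := by
    rw [map_antipode_coproduct]
    refine algHom_ext fun m _ => ?_
    rw [AlgHom.comp_apply, AlgHom.comp_apply, counit_graft, map_zero, graft_forest, lift_tree,
      antipodeAux, RTree.fold_node, map_sub, Algebra.TensorProduct.lmul'_apply_tmul, mul_one]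
    exact sub_self _
  exact DFunLike.congr_fun this x

open WithConv in
/-- The Hopf algebra of rooted trees. -/
instance : HopfAlgebra K (HR K) where
  antipode := antipode.toLinearMap
  mul_antipode_rTensor_comul := LinearMap.ext fun x => antipode_convolution x
  mul_antipode_lTensor_comul := by
    have h1 : toConv (antipode (K := K)) * toConv (AlgHom.id K (HR K)) = 1 := by
      refine WithConv.ofConv_injective (AlgHom.ext fun x => ?_)
      exact antipode_convolution x
    have h2 : toConv (antipode.comp (antipode (K := K))) * toConv (antipode (K := K)) = 1 := by
      have h := AlgHom.comp_convMul_distrib (antipode (K := K)) (toConv antipode)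
        (toConv (AlgHom.id K (HR K)))
      rw [h1] at h
      refine Eq.trans (WithConv.ofConv_injective h.symm) ?_
      refine WithConv.ofConv_injective (AlgHom.ext fun x => ?_)
      exact (antipode (K := K)).commutes _
    have h3 := left_inv_eq_right_inv h2 h1
    rw [h3] at h2
    refine LinearMap.ext fun x => ?_
    exact congrArg (fun φ : WithConv (HR K →ₐ[K] HR K) => φ.ofConv x) h2

end HR

/-! ### Hochschild cohomology of bialgebras -/

section Hochschild

variable {K H : Type} [CommRing K] [CommRing H] [Bialgebra K H]

/-- One-cocycles: `Δ ∘ L = (id ⊗ L) ∘ Δ + L ⊗ 1`. -/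
def IsHochschildCocycle (L : H →ₗ[K] H) : Prop :=
  ∀ x, Coalgebra.comul (R := K) (L x) =
    L.lTensor H (Coalgebra.comul (R := K) x) + L x ⊗ₜ[K] 1

/-- The coboundary of a functional: `∂α = (id ⊗ α) ∘ Δ - α(·) 1`. -/
def hochschildCoboundary (α : H →ₗ[K] K) : H →ₗ[K] H :=
  (TensorProduct.rid K H).toLinearMap ∘ₗ α.lTensor H ∘ₗ Coalgebra.comul -
    Algebra.linearMap K H ∘ₗ α

end Hochschild

/-! ### The Hopf algebra of polynomials, in which the variable is primitive -/

namespace PolynomialHopf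

open Polynomial

variable {K : Type} [CommRing K]

/-- The coproduct with `Δ x = x ⊗ 1 + 1 ⊗ x`. -/
def coproduct : K[X] →ₐ[K] K[X] ⊗[K] K[X] := aeval (X ⊗ₜ[K] 1 + 1 ⊗ₜ[K] X)

/-- The counit, evaluation at `0`. -/
def counit : K[X] →ₐ[K] K := aeval 0

/-- The antipode, `x ↦ -x`. -/
def antipode : K[X] →ₐ[K] K[X] := aeval (-X)

instance : Bialgebra K K[X] := Bialgebra.ofAlgHom coproduct counit
  (by
    refine Polynomial.algHom_ext ?_
    simp [coproduct, TensorProduct.add_tmul, TensorProduct.tmul_add,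
      Algebra.TensorProduct.one_def, add_assoc])
  (by refine Polynomial.algHom_ext ?_; simp [coproduct, counit])
  (by refine Polynomial.algHom_ext ?_; simp [coproduct, counit])

instance : HopfAlgebra K K[X] where
  antipode := antipode.toLinearMap
  mul_antipode_rTensor_comul := by
    have : (Algebra.TensorProduct.lmul' K).comp
        ((Algebra.TensorProduct.map antipode (.id K K[X])).comp coproduct) =
        (Algebra.ofId K K[X]).comp counit := by
      refine Polynomial.algHom_ext ?_
      simp [coproduct, counit, antipode]
    exact LinearMap.ext fun x => DFunLike.congr_fun this x
  mul_antipode_lTensor_comul := by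
    have : (Algebra.TensorProduct.lmul' K).comp
        ((Algebra.TensorProduct.map (.id K K[X]) antipode).comp coproduct) =
        (Algebra.ofId K K[X]).comp counit := by
      refine Polynomial.algHom_ext ?_
      simp [coproduct, counit, antipode]
    exact LinearMap.ext fun x => DFunLike.congr_fun this x

/-- The integration operator `x ^ n ↦ x ^ (n + 1) / (n + 1)`. -/
def integral : ℂ[X] →ₗ[ℂ] ℂ[X] :=
  (basisMonomials ℂ).constr ℂ fun n => monomial (n + 1) (1 / ((n : ℂ) + 1))

end PolynomialHopf

/-! ### Birkhoff decomposition -/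

section Birkhoff

open WithConv

variable {H A : Type} [CommRing H] [Bialgebra ℂ H] [CommRing A] [Algebra ℂ A]

/-- The pair `φm`, `φp` is a Birkhoff decomposition of `φ` with respect to the splitting of `A`
into the image and the kernel of a projection `R`: both are elements of the convolution group of
unital linear maps, `φ = φm⁻¹ ⋆ φp`, and they map the augmentation ideal to the image and to the
kernel of `R`, respectively. -/
structure IsBirkhoffDecomposition (R : A →ₗ[ℂ] A) (φ φm φp : H →ₗ[ℂ] A) : Prop where
  map_one_m : φm 1 = 1
  map_one_p : φp 1 = 1
  factor : ∃ ψ : WithConv (H →ₗ[ℂ] A),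
    ψ * toConv φm = 1 ∧ toConv φm * ψ = 1 ∧ toConv φ = ψ * toConv φp
  range_m : ∀ x, Coalgebra.counit (R := ℂ) x = 0 → φm x ∈ LinearMap.range R
  ker_p : ∀ x, Coalgebra.counit (R := ℂ) x = 0 → φp x ∈ LinearMap.ker R

end Birkhoff

/-! ### The toy model -/

namespace ToyModel

open MeasureTheory Set Polynomial Filter

/-- The target algebra of the regularized Feynman rules: functions of the external parameter `s`
and of the regulator `z`. Only their values for `s > 0` and for `z` near `0` with `0 < Re z` carry
meaning: the integrals belonging to a given forest converge there. -/
abbrev RegFun : Type := ℝ → ℂ → ℂ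

/-- The regulator tends to zero within the half plane `0 < Re z`. -/
def regulatorToZero : Filter ℂ := 𝓝[{z : ℂ | 0 < z.re}] 0

/-- The integrand `f(ζ) (s ζ)^(-z) φ_(s ζ)`. -/
def integrand (f : ℝ → ℂ) (φ : RegFun) (s : ℝ) (z : ℂ) (ζ : ℝ) : ℂ :=
  f ζ * ((s * ζ : ℝ) : ℂ) ^ (-z) * φ (s * ζ) z

/-- The analytically regularized integral operator
`φ ↦ (s ↦ ∫_0^∞ f(ζ) (s ζ)^(-z) φ_(s ζ) dζ)`. -/
def regularizedIntegral (f : ℝ → ℂ) (φ : RegFun) : RegFun :=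
  fun s z => ∫ ζ in Ioi (0 : ℝ), integrand f φ s z ζ

/-- The regularized Feynman rules: the character with `φ ∘ B₊ = regularizedIntegral f ∘ φ`. -/
def feynmanRules (f : ℝ → ℂ) : HR ℂ →ₐ[ℂ] RegFun := HR.universal (regularizedIntegral f)

/-- The momentum scheme: evaluation at `s = μ`. -/
def momentumScheme (μ : ℝ) : RegFun →ₐ[ℂ] RegFun :=
  AlgHom.pi fun _ => Pi.evalAlgHom ℂ (fun _ : ℝ => ℂ → ℂ) μ

/-- The counterterm `Z = R_μ ∘ φ ∘ S`. -/
def counterterm (f : ℝ → ℂ) (μ : ℝ) : HR ℂ →ₐ[ℂ] RegFun :=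
  (momentumScheme μ).comp ((feynmanRules f).comp (HopfAlgebra.antipodeAlgHom ℂ (HR ℂ)))

/-- The renormalized Feynman rules `φ_R = Z ⋆ φ`. -/
def renormalized (f : ℝ → ℂ) (μ : ℝ) : HR ℂ →ₐ[ℂ] RegFun :=
  (WithConv.toConv (counterterm f μ) * WithConv.toConv (feynmanRules f)).ofConv

/-- `P` is the physical limit of the renormalized rules: its evaluation at `log (s / μ)` is the
limit of the renormalized rules at `s` when the regulator is removed. -/
def IsPhysicalLimit (f : ℝ → ℂ) (μ : ℝ) (P : HR ℂ → ℂ[X]) : Prop :=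
  ∀ x : HR ℂ, ∀ s : ℝ, 0 < s →
    Tendsto (fun z => renormalized f μ x s z) regulatorToZero
      (𝓝 ((P x).eval ((Real.log (s / μ) : ℝ) : ℂ)))

/-- The Mellin transform `F(z) = ∫_0^∞ f(ζ) ζ^(-z) dζ`. -/
def mellinTransform (f : ℝ → ℂ) (z : ℂ) : ℂ := ∫ ζ in Ioi (0 : ℝ), f ζ * (ζ : ℂ) ^ (-z)

/-- For `z` near `0` with `0 < Re z`, the integral defining `F(z)` converges absolutely and
`F(z) = ∑_{n ≥ -1} c_n z^n`. -/
def HasMellinExpansion (f : ℝ → ℂ) (c : ℤ → ℂ) : Prop :=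
  ∀ᶠ z in regulatorToZero,
    IntegrableOn (fun ζ : ℝ => f ζ * (ζ : ℂ) ^ (-z)) (Ioi 0) ∧
      HasSum (fun n : ℕ => c ((n : ℤ) - 1) * z ^ ((n : ℤ) - 1)) (mellinTransform f z)

/-- The functional `η(x^n) = n! (-1)^n c_n`. -/
def eta (c : ℤ → ℂ) : ℂ[X] →ₗ[ℂ] ℂ :=
  (basisMonomials ℂ).constr ℂ fun n : ℕ => (n.factorial : ℂ) * (-1) ^ n * c n

/-- The operator `L = -c_{-1} ∫_0 + ∂η`. -/
def cocycle (c : ℤ → ℂ) : ℂ[X] →ₗ[ℂ] ℂ[X] :=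
  (-c (-1)) • PolynomialHopf.integral + hochschildCoboundary (eta c)

end ToyModel

end

/-! ### The integration cocycle on polynomials -/

namespace PolynomialHopf

open Polynomial

/-! Put `q = (s / μ) ^ (-z)`. Since `q` is multiplicative in `s`, the regularized integral sends `q
^ k` to `μ ^ (-z) * F((k + 1) z) * q ^ (k + 1)`; thus all integrals in play are Mellin transforms at
positive multiples of `z`, and they converge for `z` near `0` (`regularizedIntegral_sum`,
`feynmanRules_graft`).

The counterterm does not depend on `s`, and `R_μ ∘ φ_R = ε` because `R_μ` is an algebra morphism.
With the cocycle property of `B₊` this shows that grafting becomes, for `φ_R`, the regularized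
integral minus its value at `s = μ` (`renormalized_graft`).

The variable suited to the limit is `u = (1 - q) / z`, which tends to `log (s / μ)`. Expanding `u ^
i` in `q`, integrating, subtracting and reordering by powers of `u` turns the coefficients into
finite differences of `h(z) = z F(z)` with step `z`, divided by exactly the power of `z` that makes
them analytic. Their values at `0` are Taylor coefficients of `h`, that is the `c_n`, and they
assemble to `L (x ^ i)` (`exists_subtraction`). By induction over trees `φ_R(x)` is a polynomial in
`u` with analytic coefficients, which specializes at `z = 0` to the universal morphism of `L`
(`renormalized_mem_physicalPairs`).

The algebraic claims are formal. Coboundaries and integration are cocycles, and a cocycle induces a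
bialgebra morphism, which respects antipodes since convolution inverses are unique. The Birkhoff
decomposition is unique because the multiplicative projection `R_μ` applied to `φ_+ = φ_- ⋆ φ`
forces `φ_-` to be the inverse of `R_μ ∘ φ`. -/

theorem comul_X_pow {K : Type} [CommRing K] (n : ℕ) :
    Coalgebra.comul (R := K) (X ^ n : K[X]) =
      ∑ m ∈ Finset.range (n + 1), (n.choose m : K) • ((X ^ (n - m) : K[X]) ⊗ₜ[K] (X ^ m : K[X])) := by
  change (coproduct : K[X] →ₐ[K] _) (X ^ n : K[X]) = _
  rw [coproduct, map_pow, aeval_X, add_comm, add_pow]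
  refine Finset.sum_congr rfl fun m _ => ?_
  rw [Algebra.TensorProduct.tmul_pow, Algebra.TensorProduct.tmul_pow,
    Algebra.TensorProduct.tmul_mul_tmul, one_pow, one_pow, one_mul, mul_one,
    Nat.cast_smul_eq_nsmul, nsmul_eq_mul, mul_comm]

theorem integral_X_pow (n : ℕ) :
    integral (X ^ n : ℂ[X]) = (1 / ((n : ℂ) + 1)) • (X ^ (n + 1) : ℂ[X]) := by
  have h := (basisMonomials ℂ).constr_basis ℂ
    (fun n : ℕ => (monomial (n + 1) (1 / ((n : ℂ) + 1)) : ℂ[X])) n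
  rw [coe_basisMonomials] at h
  rw [X_pow_eq_monomial, integral, h, X_pow_eq_monomial, smul_monomial, smul_eq_mul, mul_one]

/-- In the coproduct of `X ^ (n + 1)` the term with right factor `1` supplies `L ⊗ 1`; the others
match through `(n + 1) * choose n m = choose (n + 1) (m + 1) * (m + 1)`. -/
theorem isHochschildCocycle_integral : IsHochschildCocycle integral := by
  have key : Coalgebra.comul (R := ℂ) ∘ₗ integral = integral.lTensor ℂ[X] ∘ₗ Coalgebra.comul +
      (TensorProduct.mk ℂ ℂ[X] ℂ[X]).flip 1 ∘ₗ integral := by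
    refine (basisMonomials ℂ).ext fun n => ?_
    rw [coe_basisMonomials]
    beta_reduce
    rw [← X_pow_eq_monomial]
    simp only [LinearMap.comp_apply, LinearMap.add_apply, LinearMap.flip_apply,
      TensorProduct.mk_apply]
    rw [integral_X_pow, map_smul, comul_X_pow, comul_X_pow, Finset.sum_range_succ', smul_add,
      map_sum, Finset.smul_sum]
    congr 1
    · refine Finset.sum_congr rfl fun m hm => ?_
      rw [map_smul, LinearMap.lTensor_tmul, integral_X_pow, TensorProduct.tmul_smul, smul_smul,
        smul_smul]
      congr 1
      · have h := Nat.add_one_mul_choose_eq n m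
        have h1 : (n : ℂ) + 1 ≠ 0 := Nat.cast_add_one_ne_zero n
        have h2 : (m : ℂ) + 1 ≠ 0 := Nat.cast_add_one_ne_zero m
        field_simp
        exact_mod_cast h.symm
      · rw [Nat.add_sub_add_right]
    · simp [TensorProduct.smul_tmul']
  exact fun x => LinearMap.congr_fun key x

end PolynomialHopf

/-! ### Coboundaries, and the bialgebra morphism induced by a cocycle -/

section Cocycles

open Coalgebra

variable {K H : Type} [CommRing K] [CommRing H] [Bialgebra K H]

theorem IsHochschildCocycle.add {L M : H →ₗ[K] H} (hL : IsHochschildCocycle L)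
    (hM : IsHochschildCocycle M) : IsHochschildCocycle (L + M) := fun x => by
  rw [LinearMap.add_apply, map_add, hL x, hM x, LinearMap.lTensor_add, LinearMap.add_apply,
    TensorProduct.add_tmul]
  abel

theorem IsHochschildCocycle.smul {L : H →ₗ[K] H} (hL : IsHochschildCocycle L) (a : K) :
    IsHochschildCocycle (a • L) := fun x => by
  rw [LinearMap.smul_apply, map_smul, hL x, LinearMap.lTensor_smul, LinearMap.smul_apply,
    smul_add, TensorProduct.smul_tmul']

/-- Let `A = (id ⊗ α) ∘ Δ` and `B = α(·) 1`. Coassociativity gives `Δ ∘ A = (id ⊗ A) ∘ Δ`, while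
`(id ⊗ B) ∘ Δ = A ⊗ 1` and `Δ ∘ B = B ⊗ 1`; the difference is the cocycle equation for `A - B`. -/
theorem isHochschildCocycle_coboundary (α : H →ₗ[K] K) :
    IsHochschildCocycle (hochschildCoboundary α) := by
  intro x
  have h1 : ∀ w : H ⊗[K] H, comul (R := K) (TensorProduct.rid K H (α.lTensor H w)) =
      ((TensorProduct.rid K H).toLinearMap ∘ₗ α.lTensor H).lTensor H
        (TensorProduct.assoc K H H H (comul.rTensor H w)) := by
    intro w
    induction w with
    | zero => simp
    | add a b ha hb => simp only [map_add, ha, hb]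
    | tmul a b =>
      simp only [LinearMap.lTensor_tmul, LinearMap.rTensor_tmul, TensorProduct.rid_tmul, map_smul]
      generalize comul (R := K) a = v
      induction v with
      | zero => simp
      | add c d hc hd => simp only [smul_add, hc, hd, TensorProduct.add_tmul, map_add]
      | tmul c d => simp
  have h2 : ∀ w : H ⊗[K] H, (Algebra.linearMap K H ∘ₗ α).lTensor H w =
      (TensorProduct.rid K H (α.lTensor H w)) ⊗ₜ[K] 1 := by
    intro w
    induction w with
    | zero => simp
    | add a b ha hb => simp only [map_add, ha, hb, TensorProduct.add_tmul]
    | tmul a b =>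
      simp [Algebra.algebraMap_eq_smul_one, TensorProduct.smul_tmul']
  have h3 : comul (R := K) (algebraMap K H (α x)) = algebraMap K H (α x) ⊗ₜ[K] 1 := by
    rw [Algebra.algebraMap_eq_smul_one, map_smul, Bialgebra.comul_one, Algebra.TensorProduct.one_def,
      ← TensorProduct.smul_tmul']
  have h4 : hochschildCoboundary α =
      (TensorProduct.rid K H).toLinearMap ∘ₗ α.lTensor H ∘ₗ comul - Algebra.linearMap K H ∘ₗ α :=
    rfl
  have h5 : (hochschildCoboundary α).lTensor H (comul x) =
      ((TensorProduct.rid K H).toLinearMap ∘ₗ α.lTensor H).lTensor H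
        (comul.lTensor H (comul (R := K) x)) - (Algebra.linearMap K H ∘ₗ α).lTensor H (comul x) := by
    rw [h4, LinearMap.lTensor_sub, LinearMap.sub_apply, ← LinearMap.comp_assoc,
      LinearMap.lTensor_comp]
    rfl
  rw [h5, h2, ← coassoc_apply, ← h1, h4]
  simp only [LinearMap.sub_apply, LinearMap.comp_apply, LinearEquiv.coe_coe, map_sub,
    Algebra.linearMap_apply, h3, TensorProduct.sub_tmul]
  abel

/-- Applying `ε ⊗ ε` to the cocycle equation yields `ε(L x) = ε(L x) + ε(L x)`. -/
theorem IsHochschildCocycle.counit_eq_zero {L : H →ₗ[K] H} (hL : IsHochschildCocycle L) (x : H) :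
    counit (R := K) (L x) = 0 := by
  have h1 : ∀ w : H ⊗[K] H, LinearMap.mul' K K
      (TensorProduct.map counit counit (L.lTensor H w)) =
      counit (R := K) (L (TensorProduct.lid K H (counit.rTensor H w))) := by
    intro w
    induction w with
    | zero => simp
    | add a b ha hb => simp only [map_add, ha, hb]
    | tmul a b => simp
  have h2 : ∀ w : H ⊗[K] H, LinearMap.mul' K K (TensorProduct.map counit counit w) =
      counit (R := K) (TensorProduct.lid K H (counit.rTensor H w)) := by
    intro w
    induction w with
    | zero => simp
    | add a b ha hb => simp only [map_add, ha, hb]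
    | tmul a b => simp
  have h := congrArg (fun w => LinearMap.mul' K K (TensorProduct.map counit counit w)) (hL x)
  simp only [map_add, h1, h2, rTensor_counit_comul, TensorProduct.lid_tmul, one_smul,
    TensorProduct.map_tmul, LinearMap.mul'_apply, Bialgebra.counit_one, mul_one] at h
  exact left_eq_add.mp h

/-- The morphism induced by a cocycle is a morphism of bialgebras. -/
noncomputable def HR.universalBialgHom (L : H →ₗ[K] H) (hL : IsHochschildCocycle L) :
    HR K →ₐc[K] H :=
  BialgHom.ofAlgHom (HR.universal L)
    (by
      refine HR.algHom_ext fun m _ => ?_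
      change Coalgebra.counit (R := K) (HR.universal (K := K) L (HR.graft (HR.forest m))) =
        HR.counit (HR.graft (HR.forest m))
      rw [HR.universal_graft, hL.counit_eq_zero, HR.counit_graft])
    (by
      refine HR.algHom_ext fun m hm => ?_
      have hx := HR.forest_congr hm
      generalize (HR.forest m : HR K) = x at hx
      change Algebra.TensorProduct.map (HR.universal (K := K) L) (HR.universal (K := K) L)
        (HR.coproduct x) = comul (R := K) (HR.universal (K := K) L x) at hx
      change Algebra.TensorProduct.map (HR.universal (K := K) L) (HR.universal (K := K) L)
        (HR.coproduct (HR.graft x)) = comul (R := K) (HR.universal (K := K) L (HR.graft x))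
      have ha : ∀ y : HR K ⊗[K] HR K,
          Algebra.TensorProduct.map (HR.universal (K := K) L) (HR.universal (K := K) L)
            (HR.graft.lTensor (HR K) y) =
          L.lTensor H (Algebra.TensorProduct.map (HR.universal (K := K) L)
            (HR.universal (K := K) L) y) := by
        intro y
        induction y with
        | zero => simp
        | add a b h1 h2 => simp only [map_add, h1, h2]
        | tmul a b => simp [HR.universal_graft]
      rw [HR.universal_graft, hL, HR.coproduct_graft, map_add, ha, hx,
        Algebra.TensorProduct.map_tmul, HR.universal_graft, map_one, add_comm])

end Cocycles

theorem ToyModel.isHochschildCocycle_cocycle (c : ℤ → ℂ) :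
    IsHochschildCocycle (ToyModel.cocycle c) :=
  (PolynomialHopf.isHochschildCocycle_integral.smul _).add (isHochschildCocycle_coboundary _)

/-! ### Convolution inverses and antipodes -/

section Convolution

open WithConv

/-- Composition with an algebra morphism on the left distributes over convolution, so it carries `S
⋆ id = 1` to this identity. -/
theorem AlgHom.comp_antipode_convMul {K H A : Type} [CommRing K] [CommRing H] [HopfAlgebra K H]
    [CommRing A] [Algebra K A] (φ : H →ₐ[K] A) :
    toConv (φ.comp (HopfAlgebra.antipodeAlgHom K H)) * toConv φ = 1 := by
  have h : toConv (HopfAlgebra.antipodeAlgHom K H) * toConv (AlgHom.id K H) = 1 :=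
    WithConv.ofConv_injective (AlgHom.ext fun x =>
      LinearMap.congr_fun (HopfAlgebra.mul_antipode_rTensor_comul (R := K) (A := H)) x)
  have h2 := AlgHom.comp_convMul_distrib φ (toConv (HopfAlgebra.antipodeAlgHom K H))
    (toConv (AlgHom.id K H))
  rw [h] at h2
  refine Eq.trans (WithConv.ofConv_injective h2.symm) ?_
  exact WithConv.ofConv_injective (AlgHom.ext fun x => φ.commutes _)

theorem AlgHom.convMul_comp_antipode {K H A : Type} [CommRing K] [CommRing H] [HopfAlgebra K H]
    [CommRing A] [Algebra K A] (φ : H →ₐ[K] A) :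
    toConv φ * toConv (φ.comp (HopfAlgebra.antipodeAlgHom K H)) = 1 := by
  have h : toConv (AlgHom.id K H) * toConv (HopfAlgebra.antipodeAlgHom K H) = 1 :=
    WithConv.ofConv_injective (AlgHom.ext fun x =>
      LinearMap.congr_fun (HopfAlgebra.mul_antipode_lTensor_comul (R := K) (A := H)) x)
  have h2 := AlgHom.comp_convMul_distrib φ (toConv (AlgHom.id K H))
    (toConv (HopfAlgebra.antipodeAlgHom K H))
  rw [h] at h2
  refine Eq.trans (WithConv.ofConv_injective h2.symm) ?_
  exact WithConv.ofConv_injective (AlgHom.ext fun x => φ.commutes _)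

/-- `Φ ∘ S` is a right inverse of `Φ` for convolution and `S ∘ Φ` a left inverse, hence they agree.
-/
theorem BialgHom.map_antipode {K H A : Type} [CommRing K] [CommRing H] [HopfAlgebra K H]
    [CommRing A] [HopfAlgebra K A] (Φ : H →ₐc[K] A) (x : H) :
    Φ (HopfAlgebra.antipode K x) = HopfAlgebra.antipode K (Φ x) := by
  have h1 := AlgHom.convMul_comp_antipode (Φ : H →ₐ[K] A)
  have h2 : toConv ((HopfAlgebra.antipodeAlgHom K A).comp (Φ : H →ₐ[K] A)) *
      toConv (Φ : H →ₐ[K] A) = 1 := by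
    have h := AlgHom.convMul_comp_bialgHom_distrib (toConv (HopfAlgebra.antipodeAlgHom K A))
      (toConv (AlgHom.id K A)) Φ
    have h3 := AlgHom.comp_antipode_convMul (AlgHom.id K A)
    rw [AlgHom.id_comp] at h3
    rw [h3] at h
    refine Eq.trans (WithConv.ofConv_injective h.symm) ?_
    refine WithConv.ofConv_injective (AlgHom.ext fun x => ?_)
    exact congrArg (algebraMap K A) (CoalgHomClass.counit_comp_apply Φ x)
  have h3 := left_inv_eq_right_inv h2 h1
  exact (congrArg (fun φ : WithConv (H →ₐ[K] A) => φ.ofConv x) h3).symm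

end Convolution

/-! ### Birkhoff decomposition for a multiplicative projection -/

section Birkhoff

open WithConv

variable {H A : Type} [CommRing H] [HopfAlgebra ℂ H] [CommRing A] [Algebra ℂ A]

/-- Being multiplicative, `R` distributes over the convolution; being idempotent, it fixes the
counterterm. What remains is `(R ∘ φ ∘ S) ⋆ (R ∘ φ) = 1`. -/
theorem convMul_comp_algHom_proj (R : A →ₐ[ℂ] A) (hR : ∀ a, R (R a) = R a) (φ : H →ₐ[ℂ] A) :
    R.comp (toConv (R.comp (φ.comp (HopfAlgebra.antipodeAlgHom ℂ H))) * toConv φ).ofConv =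
      (1 : WithConv (H →ₐ[ℂ] A)).ofConv := by
  rw [AlgHom.comp_convMul_distrib]
  have h : R.comp (R.comp (φ.comp (HopfAlgebra.antipodeAlgHom ℂ H))) =
      (R.comp φ).comp (HopfAlgebra.antipodeAlgHom ℂ H) := AlgHom.ext fun x => hR _
  exact (congrArg (fun ψ => (toConv ψ * toConv (R.comp φ)).ofConv) h).trans
    (congrArg WithConv.ofConv (AlgHom.comp_antipode_convMul (R.comp φ)))

/-- For a projection that is an algebra morphism, the unique Birkhoff decomposition of a character
has the counterterm `R ∘ φ ∘ S`. -/
theorem isBirkhoffDecomposition_iff (R : A →ₐ[ℂ] A) (hR : ∀ a, R (R a) = R a) (φ : H →ₐ[ℂ] A)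
    (φm φp : H →ₗ[ℂ] A) :
    IsBirkhoffDecomposition R.toLinearMap φ.toLinearMap φm φp ↔
      φm = (R.comp (φ.comp (HopfAlgebra.antipodeAlgHom ℂ H))).toLinearMap ∧
      φp = (toConv (R.comp (φ.comp (HopfAlgebra.antipodeAlgHom ℂ H))) *
        toConv φ).ofConv.toLinearMap := by
  have hZ : (R.comp φ).comp (HopfAlgebra.antipodeAlgHom ℂ H) =
      R.comp (φ.comp (HopfAlgebra.antipodeAlgHom ℂ H)) := rfl
  have hl := AlgHom.comp_antipode_convMul (R.comp φ)
  have hr := AlgHom.convMul_comp_antipode (R.comp φ)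
  have hproj := convMul_comp_algHom_proj R hR φ
  have hrange : ∀ x, R.comp (φ.comp (HopfAlgebra.antipodeAlgHom ℂ H)) x ∈
      LinearMap.range R.toLinearMap := fun x => ⟨_, rfl⟩
  rw [hZ] at hl hr
  generalize R.comp (φ.comp (HopfAlgebra.antipodeAlgHom ℂ H)) = Z at *
  have hl' : toConv Z.toLinearMap * toConv (R.comp φ).toLinearMap = 1 :=
    congrArg (fun ψ : WithConv (H →ₐ[ℂ] A) => toConv ψ.ofConv.toLinearMap) hl
  have hr' : toConv (R.comp φ).toLinearMap * toConv Z.toLinearMap = 1 :=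
    congrArg (fun ψ : WithConv (H →ₐ[ℂ] A) => toConv ψ.ofConv.toLinearMap) hr
  constructor
  · rintro ⟨h1m, h1p, ⟨ψ, hψ1, hψ2, hψ⟩, hm, hker⟩
    have hp : toConv φp = toConv φm * toConv φ.toLinearMap := by
      rw [hψ, ← mul_assoc, hψ2, one_mul]
    have hdec : ∀ x : H, Coalgebra.counit (R := ℂ)
        (x - algebraMap ℂ H (Coalgebra.counit (R := ℂ) x)) = 0 := fun x => by simp
    -- `R` fixes its image by idempotence and fixes `1` as an algebra morphism; by `x = (x - ε(x) 1)
    -- + ε(x) 1` this determines `R ∘ φm` everywhere.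
    have hRm : R.toLinearMap ∘ₗ φm = φm := by
      ext x
      obtain ⟨y, hy⟩ := hm _ (hdec x)
      have h1 : R (φm (x - algebraMap ℂ H (Coalgebra.counit (R := ℂ) x))) =
          φm (x - algebraMap ℂ H (Coalgebra.counit (R := ℂ) x)) := by
        rw [← hy]; exact hR y
      simp only [map_sub, Algebra.algebraMap_eq_smul_one, map_smul, h1m, map_one] at h1
      exact sub_left_injective h1
    have hRp : toConv (R.toLinearMap ∘ₗ φp) = 1 := by
      refine WithConv.ofConv_injective (LinearMap.ext fun x => ?_)
      have h1 : R (φp (x - algebraMap ℂ H (Coalgebra.counit (R := ℂ) x))) = 0 :=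
        LinearMap.mem_ker.1 (hker _ (hdec x))
      simp only [map_sub, Algebra.algebraMap_eq_smul_one, map_smul, h1p, map_one] at h1
      exact (sub_eq_zero.1 h1).trans (Algebra.algebraMap_eq_smul_one _).symm
    have h2 := LinearMap.algHom_comp_convMul_distrib R (toConv φm) (toConv φ.toLinearMap)
    rw [← hp] at h2
    -- `R` applied to `φp = φm ⋆ φ` gives `1 = φm ⋆ (R ∘ φ)`; so `φm` is a left inverse of `R ∘ φ`,
    -- whose right inverse is `Z`.
    have h3 : toConv φm * toConv (R.comp φ).toLinearMap = 1 := by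
      rw [← hRp]
      refine Eq.trans ?_ (congrArg toConv h2).symm
      exact congrArg (fun χ => toConv χ * toConv (R.comp φ).toLinearMap) hRm.symm
    have h4 : φm = Z.toLinearMap := WithConv.toConv_injective (left_inv_eq_right_inv h3 hr')
    refine ⟨h4, ?_⟩
    rw [h4] at hp
    exact WithConv.toConv_injective hp
  · rintro ⟨rfl, rfl⟩
    refine ⟨map_one Z, map_one (toConv Z * toConv φ).ofConv,
      ⟨toConv (R.comp φ).toLinearMap, hr', hl', ?_⟩, fun x _ => ?_, fun x hx => ?_⟩
    · change _ = toConv (R.comp φ).toLinearMap * (toConv Z.toLinearMap * toConv φ.toLinearMap)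
      rw [← mul_assoc, hr', one_mul]
    · exact hrange x
    · refine LinearMap.mem_ker.2 ((DFunLike.congr_fun hproj x).trans ?_)
      exact (congrArg (algebraMap ℂ A) hx).trans (map_zero _)

end Birkhoff

/-! ### Alternating binomial sums -/

section FiniteDifferences

/-- Up to the sign `(-1) ^ m` this is the `m`-th forward difference of `r ^ n` at `l`, which
vanishes for `n < m` and is `m!` for `n = m`. -/
theorem sum_neg_one_pow_choose_mul_add_pow (m l n : ℕ) (h : n ≤ m) :
    ∑ k ∈ Finset.range (m + 1), (-1 : ℂ) ^ k * m.choose k * ((k : ℂ) + l) ^ n =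
      if n = m then (-1) ^ m * (m.factorial : ℂ) else 0 := by
  have h1 := fwdDiff_iter_eq_sum_shift (1 : ℂ) (fun r : ℂ => r ^ n) m (l : ℂ)
  have h2 : ∑ k ∈ Finset.range (m + 1), (-1 : ℂ) ^ k * m.choose k * ((k : ℂ) + l) ^ n =
      (-1) ^ m * ((fwdDiff (1 : ℂ))^[m] (fun r : ℂ => r ^ n) (l : ℂ)) := by
    rw [h1, Finset.mul_sum]
    refine Finset.sum_congr rfl fun k hk => ?_
    have h3 : (-1 : ℂ) ^ m * (-1) ^ (m - k) = (-1) ^ k := by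
      have h4 : m = k + (m - k) := by
        have := Finset.mem_range.1 hk
        lia
      nth_rewrite 1 [h4]
      rw [pow_add, mul_assoc, ← mul_pow]
      simp
    rw [zsmul_eq_mul]
    push_cast
    rw [← h3, nsmul_eq_mul, mul_one, add_comm (k : ℂ)]
    ring
  rw [h2]
  split_ifs with hnm
  · rw [hnm, fwdDiff_iter_eq_factorial]
    simp
  · rw [fwdDiff_iter_pow_eq_zero_of_lt (lt_of_le_of_ne h hnm)]
    simp

/-- This converts powers of `q = 1 - v` into powers of `v`: expand, exchange the sums and use
`choose j (k + l) * choose (k + l) l = choose j l * choose (j - l) k`. The coefficients become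
finite differences of `g`. -/
theorem sum_neg_one_pow_choose_mul_one_sub_pow (g : ℕ → ℂ) (v : ℂ) (j : ℕ) :
    ∑ k ∈ Finset.range (j + 1), (-1 : ℂ) ^ k * j.choose k * g k * (1 - v) ^ k =
      ∑ l ∈ Finset.range (j + 1), j.choose l * v ^ l *
        ∑ k ∈ Finset.range (j - l + 1), (-1 : ℂ) ^ k * (j - l).choose k * g (k + l) := by
  have h1 : ∀ k : ℕ, (1 - v) ^ k = ∑ l ∈ Finset.range (k + 1), (-v) ^ l * k.choose l := fun k => by
    rw [sub_eq_neg_add, add_pow]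
    simp
  simp_rw [h1, Finset.mul_sum]
  rw [Finset.sum_comm' (t' := Finset.range (j + 1)) (s' := fun l => Finset.Ico l (j + 1))
    (by intro x y; simp only [Finset.mem_range, Finset.mem_Ico]; lia)]
  refine Finset.sum_congr rfl fun l hl => ?_
  have hl' : l ≤ j := Nat.lt_succ_iff.1 (Finset.mem_range.1 hl)
  rw [Finset.sum_Ico_eq_sum_range, show j + 1 - l = j - l + 1 by lia]
  refine Finset.sum_congr rfl fun k hk => ?_
  have hk' : k ≤ j - l := Nat.lt_succ_iff.1 (Finset.mem_range.1 hk)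
  have h2 : (j.choose (l + k) : ℂ) * (l + k).choose l = j.choose l * (j - l).choose k := by
    have := Nat.choose_mul (n := j) (k := l + k) (s := l) (Nat.le_add_right l k)
    rw [Nat.add_sub_cancel_left] at this
    exact_mod_cast this
  have h3 : (-1 : ℂ) ^ l * (-1) ^ l = 1 := by rw [← mul_pow]; simp
  rw [neg_pow v, add_comm k l, pow_add]
  linear_combination ((-1 : ℂ) ^ l * (-1) ^ l * (-1) ^ k * g (l + k) * v ^ l) * h2 +
    ((-1 : ℂ) ^ k * g (l + k) * v ^ l * j.choose l * (j - l).choose k) * h3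

end FiniteDifferences

/-! ### Taylor expansion and finite differences with small step -/

section Taylor

variable {h : ℂ → ℂ} {p : FormalMultilinearSeries ℂ ℂ ℂ}

/-- Each step divides out one factor `w` by `dslope`, which shifts the power series. As the
remainder is such a quotient, the identity holds for every `w`, not just near `0`. -/
theorem HasFPowerSeriesAt.exists_taylor (hp : HasFPowerSeriesAt h p 0) (m : ℕ) :
    ∃ r : ℂ → ℂ, AnalyticAt ℂ r 0 ∧
      ∀ w, h w = ∑ n ∈ Finset.range m, p.coeff n * w ^ n + w ^ m * r w := by
  induction m generalizing h p with
  | zero => exact ⟨h, hp.analyticAt, fun w => by simp⟩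
  | succ m ih =>
    obtain ⟨r, hr, hw⟩ := ih hp.has_fpower_series_dslope_fslope
    refine ⟨r, hr, fun w => ?_⟩
    have h0 : h 0 = p.coeff 0 := (hp.coeff_zero 1).symm
    have h1 := sub_smul_dslope h 0 w
    rw [hw w, sub_zero, smul_eq_mul, h0] at h1
    rw [Finset.sum_range_succ', eq_add_of_sub_eq h1.symm]
    simp only [FormalMultilinearSeries.coeff_fslope, mul_add, Finset.mul_sum, pow_succ, pow_zero,
      mul_one]
    rw [add_right_comm]
    congr 1
    · congr 1
      exact Finset.sum_congr rfl fun n _ => by ring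
    · ring

/-- Rescaled finite differences of an analytic function are analytic in the step. -/
theorem HasFPowerSeriesAt.exists_finiteDifference (hp : HasFPowerSeriesAt h p 0) (m l : ℕ) :
    ∃ κ : ℂ → ℂ, AnalyticAt ℂ κ 0 ∧ κ 0 = (-1) ^ m * m.factorial * p.coeff m ∧
      ∀ z, ∑ k ∈ Finset.range (m + 1), (-1 : ℂ) ^ k * m.choose k * h (((k : ℂ) + l) * z) =
        z ^ m * κ z := by
  -- The difference kills the degrees below `m` and extracts `(-1) ^ m * m!` times the coefficient
  -- of degree `m`; the remainder, of order `m + 1`, leaves an additional factor `z`.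
  obtain ⟨r, hr, hw⟩ := hp.exists_taylor (m + 1)
  refine ⟨fun z => (-1) ^ m * m.factorial * p.coeff m + z * ∑ k ∈ Finset.range (m + 1),
    (-1 : ℂ) ^ k * m.choose k * ((k : ℂ) + l) ^ (m + 1) * r (((k : ℂ) + l) * z), ?_, by simp, ?_⟩
  · refine analyticAt_const.add (analyticAt_id.mul ?_)
    refine Finset.analyticAt_fun_sum _ fun k _ => analyticAt_const.mul ?_
    refine AnalyticAt.fun_comp (f := fun z => ((k : ℂ) + l) * z) (by simpa using hr)
      (analyticAt_const.mul analyticAt_id)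
  · intro z
    simp_rw [hw, mul_add, Finset.sum_add_distrib]
    congr 1
    · simp_rw [Finset.mul_sum]
      rw [Finset.sum_comm]
      have h1 : ∀ n ∈ Finset.range (m + 1), ∑ k ∈ Finset.range (m + 1),
          (-1 : ℂ) ^ k * m.choose k * (p.coeff n * (((k : ℂ) + l) * z) ^ n) =
          if n = m then z ^ m * ((-1) ^ m * m.factorial * p.coeff m) else 0 := by
        intro n hn
        have h2 := sum_neg_one_pow_choose_mul_add_pow m l n
          (Nat.lt_succ_iff.1 (Finset.mem_range.1 hn))
        have h3 : ∑ k ∈ Finset.range (m + 1),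
            (-1 : ℂ) ^ k * m.choose k * (p.coeff n * (((k : ℂ) + l) * z) ^ n) =
            (p.coeff n * z ^ n) * ∑ k ∈ Finset.range (m + 1),
              (-1 : ℂ) ^ k * m.choose k * ((k : ℂ) + l) ^ n := by
          rw [Finset.mul_sum]
          refine Finset.sum_congr rfl fun k _ => ?_
          rw [mul_pow]; ring
        rw [h3, h2]
        split_ifs with hnm
        · rw [hnm]; ring
        · simp
      rw [Finset.sum_congr rfl h1]
      simp
    · simp_rw [Finset.mul_sum]
      refine Finset.sum_congr rfl fun k _ => ?_
      rw [mul_pow]; ring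

end Taylor

/-! ### The Mellin expansion and the subtraction formula -/

namespace ToyModel

open Polynomial Filter MeasureTheory

theorem regulatorToZero_le : regulatorToZero ≤ 𝓝 0 := nhdsWithin_le_nhds

theorem eventually_re_pos : ∀ᶠ z in regulatorToZero, 0 < z.re :=
  eventually_mem_nhdsWithin

theorem eventually_ne_zero : ∀ᶠ z in regulatorToZero, z ≠ 0 :=
  eventually_re_pos.mono fun z hz h => by simp [h] at hz

theorem tendsto_mul_regulatorToZero (a : ℝ) (ha : 0 < a) :
    Tendsto (fun z : ℂ => (a : ℂ) * z) regulatorToZero regulatorToZero := by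
  refine tendsto_nhdsWithin_iff.2 ⟨?_, ?_⟩
  · have : Tendsto (fun z : ℂ => (a : ℂ) * z) (𝓝 0) (𝓝 ((a : ℂ) * 0)) :=
      (continuous_const.mul continuous_id).tendsto 0
    rw [mul_zero] at this
    exact this.mono_left regulatorToZero_le
  · filter_upwards [eventually_re_pos] with z hz
    simpa using mul_pos ha hz

instance : regulatorToZero.NeBot := by
  have h : Tendsto (fun t : ℝ => (t : ℂ)) (𝓝[>] 0) regulatorToZero := by
    refine tendsto_nhdsWithin_iff.2 ⟨?_, ?_⟩
    · exact (Complex.continuous_ofReal.tendsto 0).mono_left nhdsWithin_le_nhds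
    · filter_upwards [self_mem_nhdsWithin] with t ht
      simpa using ht
  exact h.neBot

/-- The series of `z F(z)` converges at some nonzero point, hence has positive radius. Its sum is
analytic on a full neighbourhood of `0`, although `F` is controlled only for `0 < Re z`. -/
theorem HasMellinExpansion.exists_analytic {f : ℝ → ℂ} {c : ℤ → ℂ} (hf : HasMellinExpansion f c) :
    ∃ (h : ℂ → ℂ) (p : FormalMultilinearSeries ℂ ℂ ℂ), HasFPowerSeriesAt h p 0 ∧
      (∀ n : ℕ, p.coeff n = c ((n : ℤ) - 1)) ∧
      ∀ᶠ z in regulatorToZero, mellinTransform f z = h z / z := by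
  let a : ℕ → ℂ := fun n => c ((n : ℤ) - 1)
  have hs : ∀ᶠ z in regulatorToZero, HasSum (fun n => a n * z ^ n) (z * mellinTransform f z) := by
    filter_upwards [hf, eventually_ne_zero] with z hz hz0
    refine (hz.2.mul_left z).congr_fun fun n => ?_
    rw [zpow_sub_one₀ hz0, zpow_natCast]
    field_simp
    rfl
  obtain ⟨z₀, hz₀, hne⟩ := (hs.and eventually_ne_zero).exists
  let p : FormalMultilinearSeries ℂ ℂ ℂ := FormalMultilinearSeries.ofScalars ℂ a
  have hpc : ∀ n, p.coeff n = a n := fun n => FormalMultilinearSeries.coeff_ofScalars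
  have hr : 0 < p.radius := by
    refine lt_of_lt_of_le ?_ (p.le_radius_of_tendsto (r := ‖z₀‖₊) (l := 0) ?_)
    · simpa using hne
    · have h1 := hz₀.summable.tendsto_atTop_zero.norm
      rw [norm_zero] at h1
      refine h1.congr fun n => ?_
      rw [FormalMultilinearSeries.norm_apply_eq_norm_coef, hpc, norm_mul, norm_pow]
      rfl
  have hp : HasFPowerSeriesAt p.sum p 0 := ⟨_, p.hasFPowerSeriesOnBall hr⟩
  refine ⟨p.sum, p, hp, hpc, ?_⟩
  filter_upwards [hs, eventually_ne_zero, regulatorToZero_le (hasFPowerSeriesAt_iff.1 hp)]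
    with z hz hz0 hz1
  rw [zero_add] at hz1
  have h2 : (fun n => z ^ n • p.coeff n) = fun n => a n * z ^ n := by
    funext n
    rw [hpc, smul_eq_mul, mul_comm]
  rw [h2] at hz1
  rw [hz1.unique hz]
  field_simp

theorem cocycle_X_pow (c : ℤ → ℂ) (i : ℕ) :
    cocycle c (X ^ i) = (-c (-1) / (i + 1)) • X ^ (i + 1) +
      ∑ n ∈ Finset.range i, ((i.choose n : ℂ) * (n.factorial * (-1) ^ n * c n)) • X ^ (i - n) := by
  have heta : ∀ n : ℕ, eta c (X ^ n) = n.factorial * (-1) ^ n * c n := by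
    intro n
    have h := (basisMonomials ℂ).constr_basis ℂ
      (fun n : ℕ => (n.factorial : ℂ) * (-1) ^ n * c n) n
    rw [coe_basisMonomials] at h
    rw [X_pow_eq_monomial]
    exact h
  rw [cocycle, LinearMap.add_apply, LinearMap.smul_apply, PolynomialHopf.integral_X_pow, smul_smul,
    mul_one_div]
  congr 1
  rw [hochschildCoboundary]
  simp only [LinearMap.sub_apply, LinearMap.comp_apply, LinearEquiv.coe_coe,
    PolynomialHopf.comul_X_pow, map_sum, map_smul, LinearMap.lTensor_tmul, heta,
    TensorProduct.rid_tmul, Algebra.linearMap_apply]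
  -- The last term of `(id ⊗ η) ∘ Δ` is the constant `η(X ^ i)`, which the coboundary subtracts; so
  -- `L (X ^ i)` has no constant term.
  rw [Finset.sum_range_succ, Nat.choose_self, Nat.sub_self, Nat.cast_one, one_smul, pow_zero,
    Algebra.algebraMap_eq_smul_one, add_sub_cancel_right]
  exact Finset.sum_congr rfl fun n _ => smul_smul _ _ _

/-- The regularized integral of a power of `u = (1 - q) / z`, subtracted at `q = 1`, is a polynomial
in `u` whose coefficients are analytic in `z`; at `z = 0` it is the cocycle. -/
theorem exists_subtraction {h : ℂ → ℂ} {p : FormalMultilinearSeries ℂ ℂ ℂ} {c : ℤ → ℂ}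
    (hp : HasFPowerSeriesAt h p 0) (hpc : ∀ n : ℕ, p.coeff n = c ((n : ℤ) - 1)) (i : ℕ) :
    ∃ e : ℕ → ℂ → ℂ, (∀ l, AnalyticAt ℂ (e l) 0) ∧
      cocycle c (X ^ i) = ∑ l ∈ Finset.range (i + 1), e l 0 • X ^ (l + 1) ∧
      ∀ z, z ≠ 0 → ∀ u : ℂ, ∑ k ∈ Finset.range (i + 1), (-1 : ℂ) ^ k * i.choose k *
          (h (((k : ℂ) + 1) * z) / (((k : ℂ) + 1) * z)) * ((1 - z * u) ^ (k + 1) - 1) =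
        z ^ i * ∑ l ∈ Finset.range (i + 1), e l z * u ^ (l + 1) := by
  choose κ hκ hκ0 hκz using fun m l => hp.exists_finiteDifference m l
  -- The coefficient of `(z u) ^ (l + 1)` is a difference of order `i - l`, equal to `z ^ (i - l) *
  -- κ`. Together with the `1 / z` of the Mellin transform this makes `z ^ i` in total, for every
  -- `l`.
  refine ⟨fun l z => -((i + 1).choose (l + 1) / ((i : ℂ) + 1)) * κ (i - l) (l + 1) z,
    fun l => analyticAt_const.mul (hκ _ _), ?_, ?_⟩
  · rw [cocycle_X_pow, Finset.sum_range_succ, add_comm]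
    congr 1
    -- At `z = 0` the coefficient with index `l` involves `c (i - l - 1)`, so the two sums run in
    -- opposite directions; `l = i`, split off before, is the `c (-1)` term.
    · rw [← Finset.sum_range_reflect]
      refine Finset.sum_congr rfl fun n hn => ?_
      have hn' := Finset.mem_range.1 hn
      obtain ⟨d, rfl⟩ : ∃ d, i = n + d + 1 := ⟨i - 1 - n, by lia⟩
      beta_reduce
      rw [hκ0, hpc, show n + d + 1 - 1 - n = d by lia, show n + d + 1 - n = d + 1 by lia,
        show n + d + 1 - d = n + 1 by lia, Nat.choose_symm_of_eq_add
          (show n + d + 1 + 1 = (n + 1) + (d + 1) by lia), Nat.factorial_succ]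
      congr 1
      have h1 : ((n + d + 1 : ℕ) + 1 : ℂ) * (n + d + 1).choose d =
          (n + d + 1 + 1).choose (d + 1) * (d + 1) := by
        exact_mod_cast Nat.add_one_mul_choose_eq (n + d + 1) d
      have h2 : ((n + d + 1 : ℕ) + 1 : ℂ) ≠ 0 := Nat.cast_add_one_ne_zero _
      have h3 : ((d + 1 : ℕ) : ℤ) - 1 = d := by simp
      rw [h3, eq_comm, ← sub_eq_zero]
      field_simp
      push_cast at h1 ⊢
      linear_combination (-(-1 : ℂ) ^ d * d.factorial * c d) * h1
    · beta_reduce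
      rw [hκ0, hpc]
      congr 1
      simp
      ring
  · intro z hz u
    -- The order is `i + 1` since `choose i k / (k + 1) = choose (i + 1) (k + 1) / (i + 1)` absorbs
    -- the denominator of `F((k + 1) z)`. Subtracting the case `v = 0` is the subtraction at `q =
    -- 1`; it cancels the terms `k = 0` and `l = 0`.
    have h1 := sum_neg_one_pow_choose_mul_one_sub_pow (fun k => h (k * z)) (z * u) (i + 1)
    have h0 := sum_neg_one_pow_choose_mul_one_sub_pow (fun k => h (k * z)) 0 (i + 1)
    rw [Finset.sum_range_succ', Finset.sum_range_succ' (fun l => ((i + 1).choose l : ℂ) * _ * _)]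
      at h1 h0
    simp only [sub_zero, one_pow, mul_one, zero_pow (Nat.succ_ne_zero _), mul_zero, zero_mul,
      Finset.sum_const_zero, zero_add, pow_zero] at h0 h1
    have h2 := congrArg₂ (· - ·) h1 h0
    beta_reduce at h2
    rw [add_sub_add_right_eq_sub, add_sub_cancel_right, ← Finset.sum_sub_distrib] at h2
    have hi : (i : ℂ) + 1 ≠ 0 := Nat.cast_add_one_ne_zero i
    calc _ = -(1 / ((i + 1) * z)) * ∑ l ∈ Finset.range (i + 1), ((i + 1).choose (l + 1) : ℂ) *
          (z * u) ^ (l + 1) * ∑ k ∈ Finset.range (i + 1 - (l + 1) + 1),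
            (-1 : ℂ) ^ k * (i + 1 - (l + 1)).choose k * h (((k + (l + 1) : ℕ) : ℂ) * z) := by
          rw [← h2, Finset.mul_sum]
          refine Finset.sum_congr rfl fun k _ => ?_
          have hk : (k : ℂ) + 1 ≠ 0 := Nat.cast_add_one_ne_zero k
          have h3 : ((i : ℂ) + 1) * i.choose k = (i + 1).choose (k + 1) * (k + 1) := by
            exact_mod_cast Nat.add_one_mul_choose_eq i k
          rw [← sub_eq_zero]
          push_cast
          field_simp
          rw [pow_succ (-1 : ℂ)]
          linear_combination ((-1 : ℂ) ^ k * h ((k + 1) * z) * ((1 - z * u) ^ (k + 1) - 1)) * h3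
      _ = _ := by
          rw [Finset.mul_sum, Finset.mul_sum]
          refine Finset.sum_congr rfl fun l hl => ?_
          have hl' := Finset.mem_range.1 hl
          obtain ⟨d, rfl⟩ : ∃ d, i = l + d := ⟨i - l, by lia⟩
          have h3 := hκz d (l + 1) z
          beta_reduce
          rw [show l + d + 1 - (l + 1) = d by lia, show l + d - l = d by lia]
          push_cast at h3 hi ⊢
          rw [h3]
          field_simp
          ring

end ToyModel

/-! ### Induction along grafting -/

namespace HR

theorem mem_of_forest {K : Type} [CommRing K] {N : Submodule K (HR K)}
    (h : ∀ m, (forest m : HR K) ∈ N) (x : HR K) : x ∈ N := by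
  have h1 : N.mkQ = 0 := linearMap_ext fun m => (Submodule.Quotient.mk_eq_zero N).2 (h m)
  exact (Submodule.Quotient.mk_eq_zero N).1 (LinearMap.congr_fun h1 x)

/-- Every tree is the graft of a forest of smaller trees, a subalgebra is closed under the products
that form forests, and forests span. -/
theorem map_mem_of_graft {K A : Type} [CommRing K] [CommRing A] [Algebra K A] (φ : HR K →ₐ[K] A)
    (S : Subalgebra K A)
    (h : ∀ m, φ (forest m) ∈ S → φ (graft (forest m)) ∈ S) (x : HR K) : φ x ∈ S := by
  have hforest : ∀ m : Multiset RTree, (∀ t ∈ m, φ (tree t) ∈ S) → φ (forest m) ∈ S := by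
    intro m hm
    rw [forest, map_multiset_prod, Multiset.map_map]
    refine Subalgebra.multiset_prod_mem S fun a ha => ?_
    obtain ⟨t, ht, rfl⟩ := Multiset.mem_map.1 ha
    exact hm t ht
  have htree : ∀ t, φ (tree t) ∈ S :=
    RTree.induction fun m hm => by
      rw [← graft_forest]
      exact h m (hforest m hm)
  exact mem_of_forest (N := (Subalgebra.toSubmodule S).comap φ.toLinearMap)
    (fun m => hforest m fun t _ => htree t) x

end HR

/-! ### Convergence of the regularized Feynman rules -/

namespace ToyModel

open Polynomial Filter MeasureTheory Set

section RegularizedIntegral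

variable {f : ℝ → ℂ} {G G' : RegFun} {s : ℝ} {z : ℂ}

theorem regularizedIntegral_add (hG : IntegrableOn (integrand f G s z) (Ioi 0))
    (hG' : IntegrableOn (integrand f G' s z) (Ioi 0)) :
    IntegrableOn (integrand f (G + G') s z) (Ioi 0) ∧ regularizedIntegral f (G + G') s z =
      regularizedIntegral f G s z + regularizedIntegral f G' s z := by
  have h : integrand f (G + G') s z = fun ζ => integrand f G s z ζ + integrand f G' s z ζ := by
    funext ζ
    simp only [integrand, Pi.add_apply, mul_add]
  refine ⟨by rw [h]; exact hG.add hG', ?_⟩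
  simp only [regularizedIntegral, h]
  exact integral_add hG hG'

/-- Meant for scalars and for counterterms: a factor independent of `s` passes through the integral.
-/
theorem regularizedIntegral_mul {W : RegFun} {w : ℂ} (hW : ∀ s, W s z = w)
    (hG : IntegrableOn (integrand f G s z) (Ioi 0)) :
    IntegrableOn (integrand f (W * G) s z) (Ioi 0) ∧ regularizedIntegral f (W * G) s z =
      w * regularizedIntegral f G s z := by
  have h : integrand f (W * G) s z = fun ζ => w * integrand f G s z ζ := by
    funext ζ
    simp only [integrand, Pi.mul_apply, hW]
    ring
  refine ⟨by rw [h]; exact hG.const_mul w, ?_⟩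
  simp only [regularizedIntegral, h]
  exact integral_const_mul _ _

/-- The regularized integral of a polynomial in `q = (s / μ) ^ (-z)`. -/
theorem regularizedIntegral_sum {μ : ℝ} (hμ : 0 < μ) (hs : 0 < s) (N : ℕ) (a : ℕ → ℂ)
    (hG : ∀ t, 0 < t → G t z = ∑ k ∈ Finset.range N, a k * (((t / μ : ℝ) : ℂ) ^ (-z)) ^ k)
    (hint : ∀ k < N, IntegrableOn (fun ζ : ℝ => f ζ * (ζ : ℂ) ^ (-(((k : ℂ) + 1) * z))) (Ioi 0)) :
    IntegrableOn (integrand f G s z) (Ioi 0) ∧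
      regularizedIntegral f G s z = (μ : ℂ) ^ (-z) * ∑ k ∈ Finset.range N,
        a k * mellinTransform f (((k : ℂ) + 1) * z) * (((s / μ : ℝ) : ℂ) ^ (-z)) ^ (k + 1) := by
  -- Complex powers of positive reals are multiplicative, so with `q = (s / μ) ^ (-z)` the kernel
  -- `(s ζ) ^ (-z)` is `μ ^ (-z) * q * ζ ^ (-z)`. It raises the degree in `q` by one, whence the
  -- exponent `(k + 1) z`.
  have h : EqOn (integrand f G s z) (fun ζ => ∑ k ∈ Finset.range N,
      ((μ : ℂ) ^ (-z) * (a k * (((s / μ : ℝ) : ℂ) ^ (-z)) ^ (k + 1))) *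
        (f ζ * (ζ : ℂ) ^ (-(((k : ℂ) + 1) * z)))) (Ioi 0) := by
    intro ζ hζ
    have hζ' : (0 : ℝ) < ζ := hζ
    have h1 : ((s * ζ : ℝ) : ℂ) ^ (-z) =
        (μ : ℂ) ^ (-z) * (((s / μ : ℝ) : ℂ) ^ (-z) * (ζ : ℂ) ^ (-z)) := by
      rw [← Complex.mul_cpow_ofReal_nonneg (by positivity) hζ'.le, ← Complex.ofReal_mul,
        ← Complex.mul_cpow_ofReal_nonneg hμ.le (by positivity), ← Complex.ofReal_mul]
      congr 2
      field_simp
    have h2 : ((s * ζ / μ : ℝ) : ℂ) ^ (-z) = ((s / μ : ℝ) : ℂ) ^ (-z) * (ζ : ℂ) ^ (-z) := by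
      rw [← Complex.mul_cpow_ofReal_nonneg (by positivity) hζ'.le, ← Complex.ofReal_mul]
      congr 2
      ring
    have h3 : ∀ k : ℕ, (ζ : ℂ) ^ (-(((k : ℂ) + 1) * z)) = ((ζ : ℂ) ^ (-z)) ^ (k + 1) := fun k => by
      rw [← Complex.cpow_nat_mul]
      congr 1
      push_cast
      ring
    beta_reduce
    rw [integrand, hG _ (mul_pos hs hζ'), Finset.mul_sum, h1, h2]
    refine Finset.sum_congr rfl fun k _ => ?_
    rw [h3, mul_pow]
    ring
  have hint' : ∀ k ∈ Finset.range N, IntegrableOn (fun ζ : ℝ =>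
      ((μ : ℂ) ^ (-z) * (a k * (((s / μ : ℝ) : ℂ) ^ (-z)) ^ (k + 1))) *
        (f ζ * (ζ : ℂ) ^ (-(((k : ℂ) + 1) * z)))) (Ioi 0) :=
    fun k hk => (hint k (Finset.mem_range.1 hk)).const_mul _
  constructor
  · exact (integrableOn_congr_fun h measurableSet_Ioi).2 (integrable_finsetSum _ hint')
  · rw [regularizedIntegral, setIntegral_congr_fun measurableSet_Ioi h,
      integral_finsetSum _ hint', Finset.mul_sum]
    refine Finset.sum_congr rfl fun k _ => ?_
    rw [integral_const_mul, mellinTransform]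
    ring

end RegularizedIntegral

variable {f : ℝ → ℂ} {c : ℤ → ℂ}

theorem eventually_forall_lt {P : ℂ → Prop} (h : ∀ᶠ z in regulatorToZero, P z) (N : ℕ) :
    ∀ᶠ z in regulatorToZero, ∀ k < N, P (((k : ℂ) + 1) * z) := by
  have h1 : ∀ k ∈ Finset.range N, ∀ᶠ z in regulatorToZero, P (((k : ℂ) + 1) * z) := fun k _ => by
    have h2 := (tendsto_mul_regulatorToZero ((k : ℝ) + 1) (by positivity)).eventually h
    push_cast at h2
    exact h2
  filter_upwards [(Filter.eventually_all_finset _).2 h1] with z hz k hk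
  exact hz k (Finset.mem_range.2 hk)

/-- The functions that, near `z = 0`, are polynomials in `s ^ (-z)` of bounded degree. -/
def scalingPolynomials : Subalgebra ℂ RegFun where
  carrier := {G | ∃ N, ∀ᶠ z in regulatorToZero, ∃ a : ℂ[X], a.natDegree < N ∧
    ∀ s : ℝ, 0 < s → G s z = a.eval ((s : ℂ) ^ (-z))}
  mul_mem' := by
    rintro G G' ⟨N, hN⟩ ⟨N', hN'⟩
    refine ⟨N + N', ?_⟩
    filter_upwards [hN, hN'] with z ⟨a, ha, haG⟩ ⟨b, hb, hbG⟩
    refine ⟨a * b, lt_of_le_of_lt natDegree_mul_le (by lia), fun s hs => ?_⟩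
    rw [eval_mul, ← haG s hs, ← hbG s hs]
    rfl
  add_mem' := by
    rintro G G' ⟨N, hN⟩ ⟨N', hN'⟩
    refine ⟨max N N', ?_⟩
    filter_upwards [hN, hN'] with z ⟨a, ha, haG⟩ ⟨b, hb, hbG⟩
    refine ⟨a + b, lt_of_le_of_lt (natDegree_add_le _ _) (max_lt_max ha hb), fun s hs => ?_⟩
    rw [eval_add, ← haG s hs, ← hbG s hs]
    rfl
  algebraMap_mem' w := ⟨1, Eventually.of_forall fun z => ⟨C w, by simp, fun s _ => by simp⟩⟩

/-- The degree bound `N` does not vary with `z`, so only the finitely many Mellin integrals at `(k +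
1) z`, `k < N`, need to converge, and this holds for all small `z` at once. -/
theorem regularizedIntegral_mem_scalingPolynomials (hf : HasMellinExpansion f c) {G : RegFun}
    (hG : G ∈ scalingPolynomials) :
    (∀ᶠ z in regulatorToZero, ∀ s : ℝ, 0 < s → IntegrableOn (integrand f G s z) (Ioi 0)) ∧
      regularizedIntegral f G ∈ scalingPolynomials := by
  obtain ⟨N, hN⟩ := hG
  have h : ∀ᶠ z in regulatorToZero, ∃ a : ℕ → ℂ, ∀ s : ℝ, 0 < s →
      IntegrableOn (integrand f G s z) (Ioi 0) ∧
        regularizedIntegral f G s z = ∑ k ∈ Finset.range N, a k * ((s : ℂ) ^ (-z)) ^ (k + 1) := by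
    filter_upwards [hN, eventually_forall_lt hf N] with z ⟨a, ha, haG⟩ hz
    refine ⟨fun k => a.coeff k * mellinTransform f (((k : ℂ) + 1) * z), fun s hs => ?_⟩
    have h1 := regularizedIntegral_sum (f := f) (G := G) (s := s) (z := z) one_pos hs N a.coeff
      (fun t ht => by rw [haG t ht, eval_eq_sum_range' ha, div_one]) (fun k hk => (hz k hk).1)
    simpa using h1
  refine ⟨h.mono fun z ⟨a, ha⟩ s hs => (ha s hs).1, N + 1, ?_⟩
  filter_upwards [h] with z ⟨a, ha⟩
  refine ⟨∑ k ∈ Finset.range N, C (a k) * X ^ (k + 1), ?_, fun s hs => ?_⟩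
  · refine Nat.lt_succ_of_le (natDegree_sum_le_of_forall_le _ _ fun k hk => ?_)
    exact (natDegree_C_mul_X_pow_le _ _).trans (Finset.mem_range.1 hk)
  · rw [(ha s hs).2, eval_finsetSum]
    simp

theorem feynmanRules_mem_scalingPolynomials (hf : HasMellinExpansion f c) (x : HR ℂ) :
    feynmanRules f x ∈ scalingPolynomials :=
  HR.map_mem_of_graft _ _ (fun m hm => by
    rw [feynmanRules, HR.universal_graft_forest]
    exact (regularizedIntegral_mem_scalingPolynomials hf hm).2) x

/-- The regularized Feynman rules are given by convergent integrals. -/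
theorem feynmanRules_graft (hf : HasMellinExpansion f c) (x : HR ℂ) :
    ∀ᶠ z in regulatorToZero, ∀ s : ℝ, 0 < s →
      IntegrableOn (integrand f (feynmanRules f x) s z) (Ioi 0) ∧
        feynmanRules f (HR.graft x) s z = regularizedIntegral f (feynmanRules f x) s z := by
  have hint : ∀ x : HR ℂ, ∀ᶠ z in regulatorToZero, ∀ s : ℝ, 0 < s →
      IntegrableOn (integrand f (feynmanRules f x) s z) (Ioi 0) := fun x =>
    (regularizedIntegral_mem_scalingPolynomials hf (feynmanRules_mem_scalingPolynomials hf x)).1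
  -- On forests the identity holds for every `z`. Its linear extension needs convergent integrals,
  -- as `regularizedIntegral` is additive only then; the identities valid for `z` near `0` still
  -- form a submodule.
  let N : Submodule ℂ (HR ℂ) :=
    { carrier := {x | ∀ᶠ z in regulatorToZero, ∀ s : ℝ, 0 < s →
        feynmanRules f (HR.graft x) s z = regularizedIntegral f (feynmanRules f x) s z}
      zero_mem' := by
        change ∀ᶠ z in regulatorToZero, ∀ s : ℝ, 0 < s → feynmanRules f (HR.graft 0) s z =
          regularizedIntegral f (feynmanRules f 0) s z
        refine Eventually.of_forall fun z s _ => ?_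
        have h : integrand f 0 s z = fun _ => 0 := by funext ζ; simp [integrand]
        simp [regularizedIntegral, h]
      add_mem' := by
        intro x y hx hy
        filter_upwards [hx, hy, hint x, hint y] with z h1 h2 h3 h4 s hs
        rw [map_add, map_add, map_add, (regularizedIntegral_add (h3 s hs) (h4 s hs)).2,
          ← h1 s hs, ← h2 s hs]
        rfl
      smul_mem' := by
        intro w x hx
        filter_upwards [hx, hint x] with z h1 h2 s hs
        rw [map_smul, map_smul, map_smul, Algebra.smul_def w (feynmanRules f x),
          (regularizedIntegral_mul (w := w) (fun _ => rfl) (h2 s hs)).2, ← h1 s hs]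
        rfl }
  have hx : x ∈ N := HR.mem_of_forest (N := N) (fun m => by
    change ∀ᶠ z in regulatorToZero, ∀ s : ℝ, 0 < s → feynmanRules f (HR.graft (HR.forest m)) s z =
      regularizedIntegral f (feynmanRules f (HR.forest m)) s z
    refine Eventually.of_forall fun z s _ => ?_
    rw [feynmanRules, HR.universal_graft_forest]) x
  filter_upwards [hx, hint x] with z h1 h2 s hs
  exact ⟨h2 s hs, h1 s hs⟩

/-! ### Renormalization as a subtraction at `s = μ` -/

section Renormalized

theorem momentumScheme_idem (μ : ℝ) (G : RegFun) :
    momentumScheme μ (momentumScheme μ G) = momentumScheme μ G := rfl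

theorem renormalized_apply (f : ℝ → ℂ) (μ : ℝ) (x : HR ℂ) :
    renormalized f μ x = Algebra.TensorProduct.lmul' ℂ (Algebra.TensorProduct.map
      (counterterm f μ) (feynmanRules f) (HR.coproduct x)) := rfl

theorem renormalized_apply_self (f : ℝ → ℂ) (μ : ℝ) (x : HR ℂ) (z : ℂ) :
    renormalized f μ x μ z = HR.counit x :=
  congrFun (congrFun (DFunLike.congr_fun (convMul_comp_algHom_proj (momentumScheme μ)
    (momentumScheme_idem μ) (feynmanRules f)) x) μ) z

/-- The counterterm in the left tensor factor is constant in `s`, so it commutes with the integral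
that `B₊` produces on the right factor. -/
theorem convolution_graft (hf : HasMellinExpansion f c) (μ : ℝ) (y : HR ℂ ⊗[ℂ] HR ℂ) :
    ∀ᶠ z in regulatorToZero, ∀ s : ℝ, 0 < s →
      IntegrableOn (integrand f (Algebra.TensorProduct.lmul' ℂ (Algebra.TensorProduct.map
        (counterterm f μ) (feynmanRules f) y)) s z) (Ioi 0) ∧
      Algebra.TensorProduct.lmul' ℂ (Algebra.TensorProduct.map (counterterm f μ)
        (feynmanRules f) (HR.graft.lTensor (HR ℂ) y)) s z =
      regularizedIntegral f (Algebra.TensorProduct.lmul' ℂ (Algebra.TensorProduct.map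
        (counterterm f μ) (feynmanRules f) y)) s z := by
  induction y with
  | zero =>
    refine Eventually.of_forall fun z s _ => ?_
    have h : integrand f 0 s z = fun _ => 0 := by funext ζ; simp [integrand]
    simp [regularizedIntegral, h]
  | add a b ha hb =>
    filter_upwards [ha, hb] with z h1 h2 s hs
    have h := regularizedIntegral_add (h1 s hs).1 (h2 s hs).1
    simp only [map_add]
    refine ⟨h.1, h.2.symm ▸ ?_⟩
    rw [← (h1 s hs).2, ← (h2 s hs).2]
    rfl
  | tmul a b =>
    filter_upwards [feynmanRules_graft hf b] with z hz s hs
    have h := regularizedIntegral_mul (W := counterterm f μ a) (w := counterterm f μ a μ z)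
      (fun _ => rfl) (hz s hs).1
    rw [LinearMap.lTensor_tmul, Algebra.TensorProduct.map_tmul, Algebra.TensorProduct.map_tmul,
      Algebra.TensorProduct.lmul'_apply_tmul, Algebra.TensorProduct.lmul'_apply_tmul]
    refine ⟨h.1, h.2.symm ▸ ?_⟩
    rw [← (hz s hs).2]
    rfl

/-- The renormalized rules arise from subtracted integrals. -/
theorem renormalized_graft (hf : HasMellinExpansion f c) {μ : ℝ} (hμ : 0 < μ) (x : HR ℂ) :
    ∀ᶠ z in regulatorToZero, ∀ s : ℝ, 0 < s → renormalized f μ (HR.graft x) s z =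
      regularizedIntegral f (renormalized f μ x) s z -
        regularizedIntegral f (renormalized f μ x) μ z := by
  filter_upwards [convolution_graft hf μ (HR.coproduct x)] with z hz s hs
  have h1 : ∀ t : ℝ, 0 < t → renormalized f μ (HR.graft x) t z =
      counterterm f μ (HR.graft x) μ z + regularizedIntegral f (renormalized f μ x) t z := by
    intro t ht
    rw [renormalized_apply, renormalized_apply, ← (hz t ht).2, HR.coproduct_graft, map_add, map_add,
      Algebra.TensorProduct.map_tmul, Algebra.TensorProduct.lmul'_apply_tmul, map_one, mul_one]
    rfl
  -- At `s = μ` the renormalized rules equal the counit, which vanishes on grafts; this expresses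
  -- the unknown counterterm as minus the integral at `μ`.
  have h2 := h1 μ hμ
  rw [renormalized_apply_self, HR.counit_graft] at h2
  rw [h1 s hs]
  linear_combination -h2

end Renormalized

end ToyModel

/-- The functions that are analytic at `0`. -/
def analyticAtZero : Subalgebra ℂ (ℂ → ℂ) where
  carrier := {g | AnalyticAt ℂ g 0}
  mul_mem' h1 h2 := h1.mul h2
  add_mem' h1 h2 := h1.add h2
  algebraMap_mem' _ := analyticAt_const

/-! ### Analytic continuation and the physical limit -/

namespace ToyModel

open Polynomial Filter MeasureTheory Set

/-- Evaluation of functions analytic at `0`. -/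
def evalAt (z : ℂ) : analyticAtZero →+* ℂ :=
  (Pi.evalRingHom (fun _ => ℂ) z).comp analyticAtZero.subtype

theorem evalAt_apply (z : ℂ) (g : analyticAtZero) : evalAt z g = (g : ℂ → ℂ) z := rfl

/-- The difference quotient `(1 - (s / μ) ^ (-z)) / z`, which tends to `log (s / μ)`. -/
noncomputable def logQuotient (μ s : ℝ) (z : ℂ) : ℂ := (1 - ((s / μ : ℝ) : ℂ) ^ (-z)) / z

/-- Pairs of a regularized function and its physical limit, where the former is a polynomial in
`logQuotient` with coefficients analytic in the regulator. -/
noncomputable def physicalPairs (μ : ℝ) : Subalgebra ℂ (RegFun × ℂ[X]) where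
  carrier := {p | ∃ B : (analyticAtZero)[X], (∀ᶠ z in regulatorToZero, ∀ s : ℝ, 0 < s →
    p.1 s z = B.eval₂ (evalAt z) (logQuotient μ s z)) ∧ p.2 = B.map (evalAt 0)}
  mul_mem' := by
    rintro p p' ⟨B, hB, hp⟩ ⟨B', hB', hp'⟩
    refine ⟨B * B', ?_, by rw [Polynomial.map_mul, ← hp, ← hp', Prod.snd_mul]⟩
    filter_upwards [hB, hB'] with z h1 h2 s hs
    rw [eval₂_mul, ← h1 s hs, ← h2 s hs]
    rfl
  add_mem' := by
    rintro p p' ⟨B, hB, hp⟩ ⟨B', hB', hp'⟩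
    refine ⟨B + B', ?_, by rw [Polynomial.map_add, ← hp, ← hp', Prod.snd_add]⟩
    filter_upwards [hB, hB'] with z h1 h2 s hs
    rw [eval₂_add, ← h1 s hs, ← h2 s hs]
    rfl
  algebraMap_mem' w := by
    refine ⟨C (algebraMap ℂ analyticAtZero w), Eventually.of_forall fun z s _ => ?_, ?_⟩
    · rw [eval₂_C]
      rfl
    · rw [map_C]
      rfl

theorem physicalPairs_congr {μ : ℝ} {G G' : RegFun} {P : ℂ[X]} (hG : (G, P) ∈ physicalPairs μ)
    (h : ∀ᶠ z in regulatorToZero, ∀ s : ℝ, 0 < s → G' s z = G s z) :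
    (G', P) ∈ physicalPairs μ := by
  obtain ⟨B, hB, hP⟩ := hG
  refine ⟨B, ?_, hP⟩
  filter_upwards [hB, h] with z h1 h2 s hs
  exact (h2 s hs).trans (h1 s hs)

variable {f : ℝ → ℂ} {c : ℤ → ℂ}

theorem analyticAt_cpow_neg {μ : ℝ} (hμ : 0 < μ) : AnalyticAt ℂ (fun z : ℂ => (μ : ℂ) ^ (-z)) 0 :=
  analyticAt_const.cpow analyticAt_id.neg (Or.inl (by simpa using hμ))

theorem logQuotient_pow (μ s : ℝ) (z : ℂ) (i : ℕ) : logQuotient μ s z ^ i =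
    ∑ k ∈ Finset.range (i + 1),
      ((z ^ i)⁻¹ * ((-1) ^ k * i.choose k)) * (((s / μ : ℝ) : ℂ) ^ (-z)) ^ k := by
  rw [logQuotient, div_pow, sub_eq_neg_add, add_pow, Finset.sum_div]
  refine Finset.sum_congr rfl fun k _ => ?_
  rw [neg_pow (((s / μ : ℝ) : ℂ) ^ (-z)), one_pow]
  ring

/-- The subtracted regularized integral of a power of `logQuotient`. -/
theorem exists_regularizedIntegral_logQuotient_pow (hf : HasMellinExpansion f c) {μ : ℝ}
    (hμ : 0 < μ) (i : ℕ) :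
    ∃ E : (analyticAtZero)[X], cocycle c (X ^ i) = E.map (evalAt 0) ∧
      ∀ᶠ z in regulatorToZero, ∀ s : ℝ, 0 < s →
        IntegrableOn (integrand f (fun t z => logQuotient μ t z ^ i) s z) (Ioi 0) ∧
        regularizedIntegral f (fun t z => logQuotient μ t z ^ i) s z -
            regularizedIntegral f (fun t z => logQuotient μ t z ^ i) μ z =
          E.eval₂ (evalAt z) (logQuotient μ s z) := by
  obtain ⟨h, p, hp, hpc, hh⟩ := hf.exists_analytic
  obtain ⟨e, he, he0, hez⟩ := exists_subtraction hp hpc i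
  -- The prefactor `μ ^ (-z)` of the regularized integral is analytic and equals `1` at `z = 0`, so
  -- it joins the coefficients without changing the limit.
  let e' : ℕ → analyticAtZero := fun l =>
    ⟨fun z => (μ : ℂ) ^ (-z) * e l z, (analyticAt_cpow_neg hμ).mul (he l)⟩
  refine ⟨∑ l ∈ Finset.range (i + 1), C (e' l) * X ^ (l + 1), ?_, ?_⟩
  · rw [he0, Polynomial.map_sum]
    refine Finset.sum_congr rfl fun l _ => ?_
    rw [Polynomial.map_mul, map_C, Polynomial.map_pow, map_X, smul_eq_C_mul, evalAt_apply]
    simp [e']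
  · filter_upwards [eventually_forall_lt (hf.and hh) (i + 1), eventually_ne_zero] with z hz hz0 s hs
    have h1 : ∀ t : ℝ, 0 < t → _ := fun t ht =>
      regularizedIntegral_sum (f := f) (G := fun t z => logQuotient μ t z ^ i) (z := z) hμ ht (i + 1)
        _ (fun t _ => logQuotient_pow μ t z i) (fun k hk => (hz k hk).1.1)
    refine ⟨(h1 s hs).1, ?_⟩
    have hq : ((s / μ : ℝ) : ℂ) ^ (-z) = 1 - z * logQuotient μ s z := by
      rw [logQuotient]
      field_simp
      ring
    rw [(h1 s hs).2, (h1 μ hμ).2, ← mul_sub, ← Finset.sum_sub_distrib, hq, div_self hμ.ne',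
      Complex.ofReal_one, Complex.one_cpow, eval₂_finsetSum]
    have h2 : ∀ l ∈ Finset.range (i + 1), (C (e' l) * X ^ (l + 1)).eval₂ (evalAt z)
        (logQuotient μ s z) = (μ : ℂ) ^ (-z) * (e l z * logQuotient μ s z ^ (l + 1)) := by
      intro l _
      rw [eval₂_mul, eval₂_C, eval₂_X_pow, evalAt_apply, mul_assoc]
    rw [Finset.sum_congr rfl h2, ← Finset.mul_sum]
    congr 1
    refine mul_left_cancel₀ (pow_ne_zero i hz0) ?_
    rw [← hez z hz0, Finset.mul_sum]
    refine Finset.sum_congr rfl fun k hk => ?_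
    rw [(hz k (Finset.mem_range.1 hk)).2]
    field_simp
    ring

/-- The coefficients of a polynomial in `logQuotient` depend on `z` alone, so they leave the
integral and the case of a single power suffices. -/
theorem regularizedIntegral_mem_physicalPairs (hf : HasMellinExpansion f c) {μ : ℝ} (hμ : 0 < μ)
    {G : RegFun} {P : ℂ[X]} (hG : (G, P) ∈ physicalPairs μ) :
    ((fun s z => regularizedIntegral f G s z - regularizedIntegral f G μ z : RegFun),
      cocycle c P) ∈ physicalPairs μ := by
  obtain ⟨B, hB, hP⟩ := hG
  choose E hE0 hE using exists_regularizedIntegral_logQuotient_pow hf hμ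
  have hsum : ∀ {R : Type} [CommRing R] (φ : analyticAtZero →+* R) (u : R),
      B.eval₂ φ u = ∑ i ∈ Finset.range (B.natDegree + 1), φ (B.coeff i) * u ^ i :=
    fun φ u => eval₂_eq_sum_range φ u
  refine ⟨∑ i ∈ Finset.range (B.natDegree + 1), C (B.coeff i) * E i, ?_, ?_⟩
  · filter_upwards [hB, (Filter.eventually_all_finset (Finset.range (B.natDegree + 1))).2
      fun i _ => hE i] with z h1 h2 s hs
    have h3 : ∀ t : ℝ, 0 < t → regularizedIntegral f G t z =
        ∑ i ∈ Finset.range (B.natDegree + 1), evalAt z (B.coeff i) *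
          regularizedIntegral f (fun t z => logQuotient μ t z ^ i) t z := by
      intro t ht
      have h4 : EqOn (integrand f G t z) (fun ζ => ∑ i ∈ Finset.range (B.natDegree + 1),
          evalAt z (B.coeff i) * integrand f (fun t z => logQuotient μ t z ^ i) t z ζ)
          (Ioi 0) := by
        intro ζ hζ
        rw [integrand, h1 _ (mul_pos ht hζ), hsum, Finset.mul_sum]
        refine Finset.sum_congr rfl fun i _ => ?_
        rw [integrand]
        ring
      rw [regularizedIntegral, setIntegral_congr_fun measurableSet_Ioi h4,
        integral_finsetSum _ fun i hi => ((h2 i hi t ht).1.const_mul _)]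
      exact Finset.sum_congr rfl fun i _ => integral_const_mul _ _
    rw [h3 s hs, h3 μ hμ, ← Finset.sum_sub_distrib, eval₂_finsetSum]
    refine Finset.sum_congr rfl fun i hi => ?_
    rw [← mul_sub, (h2 i hi s hs).2, eval₂_mul, eval₂_C]
  · change cocycle c P = _
    change P = _ at hP
    have h5 : B.map (evalAt 0) =
        ∑ i ∈ Finset.range (B.natDegree + 1), evalAt 0 (B.coeff i) • X ^ i := by
      rw [Polynomial.map, eval₂_eq_sum_range]
      exact Finset.sum_congr rfl fun i _ => (smul_eq_C_mul _).symm
    rw [hP, h5, map_sum, Polynomial.map_sum]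
    refine Finset.sum_congr rfl fun i _ => ?_
    rw [map_smul, hE0, Polynomial.map_mul, map_C, smul_eq_C_mul]

/-- The regularized function and its limit are carried through the induction as one character into
the product algebra: grafting subtracts an integral in the first component and applies `L` in the
second. -/
theorem renormalized_mem_physicalPairs (hf : HasMellinExpansion f c) {μ : ℝ} (hμ : 0 < μ)
    (x : HR ℂ) : (renormalized f μ x, HR.universal (K := ℂ) (cocycle c) x) ∈ physicalPairs μ :=
  HR.map_mem_of_graft ((renormalized f μ).prod (HR.universal (K := ℂ) (cocycle c)))
    (physicalPairs μ) (fun m hm => by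
      have h := regularizedIntegral_mem_physicalPairs hf hμ
        (show (renormalized f μ (HR.forest m), HR.universal (K := ℂ) (cocycle c) (HR.forest m)) ∈
          physicalPairs μ from hm)
      rw [← HR.universal_graft] at h
      exact physicalPairs_congr h (renormalized_graft hf hμ (HR.forest m))) x

/-- Elements of `physicalPairs` continue analytically to `z = 0`. -/
theorem exists_analyticAt_of_mem_physicalPairs {μ : ℝ} (hμ : 0 < μ) {G : RegFun} {P : ℂ[X]}
    (hG : (G, P) ∈ physicalPairs μ) {s : ℝ} (hs : 0 < s) :
    ∃ g : ℂ → ℂ, AnalyticAt ℂ g 0 ∧ (∀ᶠ z in regulatorToZero, G s z = g z) ∧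
      g 0 = P.eval ((Real.log (s / μ) : ℝ) : ℂ) := by
  obtain ⟨B, hB, hP⟩ := hG
  change P = _ at hP
  have hsμ : 0 < s / μ := div_pos hs hμ
  have hq := analyticAt_cpow_neg hsμ
  obtain ⟨p, hp⟩ := hq
  -- `dslope` removes the singularity of `logQuotient` at `z = 0`, filling in minus the derivative
  -- of `(s / μ) ^ (-z)`, which is `log (s / μ)`.
  let U : ℂ → ℂ := fun z => -dslope (fun z : ℂ => ((s / μ : ℝ) : ℂ) ^ (-z)) 0 z
  have hU : AnalyticAt ℂ U 0 := hp.has_fpower_series_dslope_fslope.analyticAt.neg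
  have hU0 : U 0 = ((Real.log (s / μ) : ℝ) : ℂ) := by
    have h1 : HasDerivAt (fun z : ℂ => ((s / μ : ℝ) : ℂ) ^ (-z))
        (((s / μ : ℝ) : ℂ) ^ (-(0 : ℂ)) * Complex.log ((s / μ : ℝ) : ℂ) * -1) 0 :=
      (hasDerivAt_neg (0 : ℂ)).const_cpow (Or.inl (by exact_mod_cast hsμ.ne'))
    simp only [U, dslope_same, h1.deriv]
    rw [neg_zero, Complex.cpow_zero, ← Complex.ofReal_log hsμ.le]
    ring
  refine ⟨fun z => B.eval₂ (evalAt z) (U z), ?_, ?_, ?_⟩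
  · have h1 : (fun z => B.eval₂ (evalAt z) (U z)) = fun z =>
        ∑ i ∈ Finset.range (B.natDegree + 1), (B.coeff i : ℂ → ℂ) z * U z ^ i :=
      funext fun z => eval₂_eq_sum_range _ _
    rw [h1]
    exact Finset.analyticAt_fun_sum _ fun i _ => (B.coeff i).2.mul (hU.pow i)
  · filter_upwards [hB, eventually_ne_zero] with z hz hz0
    have h1 : U z = logQuotient μ s z := by
      simp only [U, dslope_of_ne _ hz0, slope, logQuotient, vsub_eq_sub, smul_eq_mul, sub_zero,
        neg_zero, Complex.cpow_zero]
      ring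
    rw [hz s hs, h1]
  · beta_reduce
    rw [hU0, hP, eval_map]

end ToyModel

theorem mainTheorem1 (f : ℝ → ℂ) (c : ℤ → ℂ) (hf : ToyModel.HasMellinExpansion f c) :
    -- the regularized Feynman rules are given by convergent integrals near `z = 0`, `0 < Re z`
    (∀ x : HR ℂ, ∀ᶠ z in ToyModel.regulatorToZero, ∀ s : ℝ, 0 < s →
      MeasureTheory.IntegrableOn
          (ToyModel.integrand f (ToyModel.feynmanRules f x) s z) (Set.Ioi 0) ∧
        ToyModel.feynmanRules f (HR.graft x) s z =
          ToyModel.regularizedIntegral f (ToyModel.feynmanRules f x) s z) ∧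
    -- `L` is a cocycle and the universal morphism is a morphism of Hopf algebras
    IsHochschildCocycle (ToyModel.cocycle c) ∧
    (∃ Φ : HR ℂ →ₐc[ℂ] Polynomial ℂ,
      (∀ x, Φ x = HR.universal (K := ℂ) (ToyModel.cocycle c) x) ∧
      ∀ x, Φ (HopfAlgebra.antipode ℂ x) = HopfAlgebra.antipode ℂ (Φ x)) ∧
    ∀ μ : ℝ, 0 < μ →
      -- counterterm and renormalized rules are the unique Birkhoff decomposition
      (∀ φm φp : HR ℂ →ₗ[ℂ] ToyModel.RegFun,
        IsBirkhoffDecomposition (ToyModel.momentumScheme μ).toLinearMap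
            (ToyModel.feynmanRules f).toLinearMap φm φp ↔
          φm = (ToyModel.counterterm f μ).toLinearMap ∧
            φp = (ToyModel.renormalized f μ).toLinearMap) ∧
      -- the physical limit exists and is the universal morphism
      (∀ P : HR ℂ → Polynomial ℂ,
        ToyModel.IsPhysicalLimit f μ P ↔
          P = fun x => HR.universal (K := ℂ) (ToyModel.cocycle c) x) ∧
      -- it is also the value at `z = 0` of the analytic continuation in `z`
      ∀ x : HR ℂ, ∀ s : ℝ, 0 < s → ∃ g : ℂ → ℂ, AnalyticAt ℂ g 0 ∧
        (∀ᶠ z in ToyModel.regulatorToZero, ToyModel.renormalized f μ x s z = g z) ∧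
        g 0 = (HR.universal (K := ℂ) (ToyModel.cocycle c) x).eval
          ((Real.log (s / μ) : ℝ) : ℂ) := by
  have hL := ToyModel.isHochschildCocycle_cocycle c
  refine ⟨ToyModel.feynmanRules_graft hf, hL, ⟨HR.universalBialgHom _ hL, fun _ => rfl,
    fun x => BialgHom.map_antipode (HR.universalBialgHom _ hL) x⟩, fun μ hμ => ?_⟩
  have hcont := fun (x : HR ℂ) (s : ℝ) (hs : 0 < s) =>
    ToyModel.exists_analyticAt_of_mem_physicalPairs hμ
      (ToyModel.renormalized_mem_physicalPairs hf hμ x) hs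
  have hlim : ToyModel.IsPhysicalLimit f μ
      fun x => HR.universal (K := ℂ) (ToyModel.cocycle c) x := by
    intro x s hs
    obtain ⟨g, hg, hgG, hg0⟩ := hcont x s hs
    rw [← hg0]
    exact (hg.continuousAt.tendsto.mono_left ToyModel.regulatorToZero_le).congr'
      (hgG.mono fun z hz => hz.symm)
  refine ⟨fun φm φp => isBirkhoffDecomposition_iff (ToyModel.momentumScheme μ)
    (ToyModel.momentumScheme_idem μ) (ToyModel.feynmanRules f) φm φp, fun P => ⟨fun hP => ?_, ?_⟩,
    hcont⟩
  · funext x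
    have heq : ∀ t : ℝ, (P x).eval (t : ℂ) =
        (HR.universal (K := ℂ) (ToyModel.cocycle c) x).eval (t : ℂ) := by
      intro t
      -- The choice `s = μ * exp t` makes `log (s / μ)` an arbitrary real `t`, and a polynomial is
      -- determined by its values on the real line.
      have hs : 0 < μ * Real.exp t := by positivity
      have h1 := tendsto_nhds_unique (hP x _ hs) (hlim x _ hs)
      rwa [mul_div_cancel_left₀ _ hμ.ne', Real.log_exp] at h1
    refine Polynomial.eq_of_infinite_eval_eq _ _ (Set.Infinite.mono ?_
      (Set.infinite_range_of_injective Complex.ofReal_injective))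
    rintro _ ⟨t, rfl⟩
    exact heq t
  · rintro rfl
    exact hlim
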